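/- Conventions. $M_2(\mathbb{C})$ is the monoid of $2\times2$ complex matrices, $M_2^0(\mathbb{C})$ its subsemigroup of singular matrices, and $\pi:M_2(\mathbb{C})\to PM_2(\mathbb{C})=M_2(\mathbb{C})/\mathbb{C}^\times$ the natural surjection. The class of a rank one matrix is identified with the pair $(v,u)\in(\mathbb{C}P^1)^2$ where $v$ is its image and $u$ its kernel, and for $F,G\subseteq\mathbb{C}P^1$ we put $B_{F,G}=\{(v,u):v\in F,\ u\in G\}\cup\{0\}$. Idempotents are nonzero by convention. Definable means first-order definable in the field $\mathbb{C}$ (language of rings, parameters allowed); $\infty$-definable means: the intersection of a small family, i.e. of fewer than $|\mathbb{C}|=2^{\aleph_0}$, definable sets. For $S\subseteq M_2^0(\mathbb{C})$ and $x\in S$ let $Z_x=\{z\in\mathbb{C}^\times: zx\in S\}$; $S$ has equal multiplicity $Z_S$ if $Z_x=Z_S$ for all $x\in S\setminus\{0\}$. For $Z\subseteq\mathbb{C}^\times$ let $ZB_{F,G}=\{0\}\cup\bigcup\{Z\cdot e: e \text{ idempotent},\ \pi(e)\in B_{F,G}\}$. Proposition. Let $S$ be an $\infty$-definable subsemigroup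 of $M_2^0(\mathbb{C})$ such that $\pi(S)=B_{F,G}$, or, if $0\notin S$, $\pi(S)=B_{F,G}\setminus\{0\}$. (1) If $S$ has no nonzero nilpotents, then $S$ has equal multiplicity $Z_S$, and $S\cup\{0\}=Z_SB_{F,G}$ and $S\setminus\{0\}=\bigcup_{e\in S\text{ idempotent}}Z_S\cdot e$. If moreover $B_{F,G}$ is infinite and $|F|,|G|>1$, then $Z_S=\mathbb{C}^\times$. (2) Suppose $S$ has a nonzero nilpotent. (a) If $|F|>1$ and $|G|>1$, then $S$ has equal multiplicity $Z_S$, and $S=\bigcup_{e\in S\text{ idempotent}}Z_S\cdot e\ \cup\ \{n\in S: n^2=0\}$. If moreover $B_{F,G}$ is infinite, then $Z_S=\mathbb{C}^\times$ and $S=\pi^{-1}(B_{F,G})$. (b) If $|F|=1$ or $|G|=1$, then for every nonzero nilpotent $n\in S$ and every idempotent $e\in S$ one has $S=Z_eB_{F,G}\cup Z_n\cdot n$; if $S$ has no idempotent, then $S=\{0\}\cup Z_n\cdot n$ for every nonzero nilpotent $n\in S$. If $0\notin S$, then $S$ has no nilpotents, so only (1) applies. Furthermore, $S$ is the intersection of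 a family of fewer than $2^{\aleph_0}$ definable subsemigroups of $M_2^0(\mathbb{C})$. -/

import Mathlib

open Cardinal
open scoped LinearAlgebra.Projectivization

noncomputable section

namespace SingularSemigroup

/-- The monoid `M₂(ℂ)`. -/
abbrev M2 : Type := Matrix (Fin 2) (Fin 2) ℂ

/-- The complex projective line. -/
abbrev CP1 : Type := ℙ ℂ (Fin 2 → ℂ)

/-- `PM₂(ℂ) = M₂(ℂ)/ℂˣ`, the quotient by scalar multiplication. -/
abbrev PM2 : Type := MulAction.orbitRel.Quotient ℂˣ M2

/-- The natural surjection `π : M₂(ℂ) → PM₂(ℂ)`. -/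
def proj (x : M2) : PM2 := Quotient.mk (MulAction.orbitRel ℂˣ M2) x

/-- The (nonzero, singular) matrix `x` has image `v` and kernel `u`; its class in `PM₂(ℂ)` is
then identified with the pair `(v, u)`. -/
def HasImageKernel (x : M2) (v u : CP1) : Prop :=
  LinearMap.range x.mulVecLin = v.submodule ∧ LinearMap.ker x.mulVecLin = u.submodule

/-- `B_{F,G} = {(v, u) : v ∈ F, u ∈ G} ∪ {0}`, the first coordinate being the image and the
second one the kernel. -/
def B (F G : Set CP1) : Set PM2 :=
  {p | p = proj 0 ∨ ∃ x : M2, p = proj x ∧ ∃ v ∈ F, ∃ u ∈ G, HasImageKernel x v u}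

/-- A set of matrices is definable (with parameters from `ℂ`) in the language of rings;
matrices are identified with the tuples of their entries. -/
def IsDefinable (X : Set M2) : Prop :=
  letI := FirstOrder.Ring.compatibleRingOfRing ℂ
  (Set.univ : Set ℂ).Definable FirstOrder.Language.ring
    {a : Fin 2 × Fin 2 → ℂ | Matrix.of (fun i j => a (i, j)) ∈ X}

/-- `∞`-definable: the intersection of a small family of definable sets. As usual small means of
cardinality less than the degree of saturation of the ambient structure, here `|ℂ| = 𝔠`. -/
def IsInftyDefinable (X : Set M2) : Prop :=
  ∃ D : Set (Set M2), #D < 𝔠 ∧ (∀ Y ∈ D, IsDefinable Y) ∧ X = ⋂₀ D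

/-- `X` is the intersection of a small family of definable subsemigroups of the semigroup of
singular matrices. -/
def IsInterOfDefinableSemigroups (X : Set M2) : Prop :=
  ∃ D : Set (Subsemigroup M2), #D < 𝔠 ∧
    (∀ T ∈ D, IsDefinable (T : Set M2) ∧ ∀ x ∈ T, x.det = 0) ∧ X = ⋂ T ∈ D, (T : Set M2)

/-- The idempotent matrices; by convention zero is not an idempotent. -/
def Idem : Set M2 := {e | e * e = e ∧ e ≠ 0}

/-- The nilpotent matrices (zero included). -/
def Nil : Set M2 := {n | n * n = 0}

/-- The multiplicity `Z_x = {z ∈ ℂˣ : z x ∈ S}`. -/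
def mult (S : Set M2) (x : M2) : Set ℂˣ := {z | z • x ∈ S}

/-- `S` has equal multiplicity `Z`: `Z_x = Z` for all `x ∈ S \ {0}`. -/
def HasEqualMultiplicity (S : Set M2) (Z : Set ℂˣ) : Prop :=
  ∀ x ∈ S, x ≠ 0 → mult S x = Z

/-- `Z · x = {z x : z ∈ Z}`. -/
def scale (Z : Set ℂˣ) (x : M2) : Set M2 := {y | ∃ z ∈ Z, y = z • x}

/-- `Z B_{F,G}`: zero, and all `z e` with `z ∈ Z` and `e` an idempotent such that
`π(e) ∈ B_{F,G}`. -/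
def scaleB (Z : Set ℂˣ) (F G : Set CP1) : Set M2 :=
  {0} ∪ ⋃ e ∈ {e ∈ Idem | proj e ∈ B F G}, scale Z e

end SingularSemigroup

end

/-! A singular matrix is a product p qᵀ, and (p qᵀ)(p' q'ᵀ) = (q ⬝ p') p q'ᵀ. Up to scalars and
zero, S is therefore a rectangle A × C of admissible column vectors p and row vectors q (`IsRect`).
Multiplication is governed by the pairing q ⬝ p, whose zeros are the nilpotents.

Model theory enters only through strong minimality of ℂ. A definable set meets each affine line of
matrices in a finite or cofinite set, so an ∞-definable one meets it in a finite set or in one with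
complement smaller than the continuum. Applied to the line through 0 and an idempotent e, this makes
Z_e, which is closed under products, a finite group or all of ℂˣ (`exists_subgroup_mult`). In
particular, an idempotent lies in S as soon as its class lies in π(S).

If every p pairs nontrivially with some q and conversely, then any nonzero x ∈ S can be moved to a
multiple of any nonzero y ∈ S by multiplying on both sides; this forces equal multiplicity
(`exists_equal_mult`). If the common group is finite, cross-ratios of points of F and G take
finitely many values, so B_{F,G} is finite when |F|, |G| > 1 (`lineFinite_of_finite_mult`). If all
images coincide, idempotents are left identities and the nonzero nilpotents are proportional, which
gives (2b); transposition exchanges F and G.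

For definable envelopes, the line dichotomy applied to a line of idempotents shows that A and C each
consist of finitely many lines or omit fewer than continuum many. With both sides having more than
one direction, S is finite, or S ∪ {0} is cut out by conditions on columns and rows. With one
direction on a side, a condition on eigenvalues and on the line of nilpotents is added. If 0 ∉ S, a
further intersection excludes zero (`exists_zero_notMem`). -/

/-! ### Strong minimality of algebraically closed fields. -/

/-- Two transcendental elements of an algebraically closed extension are conjugate. -/
theorem IsAlgClosed.exists_ringEquiv_apply_eq_of_transcendental {k M : Type*} [Field k] [Field M]
    [Algebra k M] [IsAlgClosed M] {x y : M} (hx : Transcendental k x) (hy : Transcendental k y) :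
    ∃ σ : M ≃+* M, (∀ c, σ (algebraMap k M c) = algebraMap k M c) ∧ σ x = y := by
  have key : ∀ z : M, Transcendental k z →
      ∃ t : Set M, z ∈ t ∧ IsTranscendenceBasis k ((↑) : t → M) := fun z hz => by
    obtain ⟨t, hzt, ht⟩ := exists_isTranscendenceBasis_superset (R := k) (s := {z})
      ((algebraicIndependent_unique_type_iff (ι := ({z} : Set M))).mpr hz)
    exact ⟨t, hzt rfl, ht⟩
  obtain ⟨s, hxs, hs⟩ := key x hx
  obtain ⟨t, hyt, ht⟩ := key y hy
  classical
  obtain ⟨e₀⟩ : Nonempty (s ≃ t) := Cardinal.eq.1 (by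
    rw [hs.cardinalMk_eq_trdeg, ht.cardinalMk_eq_trdeg])
  -- Any bijection of the two transcendence bases is corrected by a transposition so that it sends x
  -- to y.
  let e : s ≃ t := e₀.trans (Equiv.swap (e₀ ⟨x, hxs⟩) ⟨y, hyt⟩)
  have he : e ⟨x, hxs⟩ = ⟨y, hyt⟩ := by simp [e]
  let a := hs.1.aevalEquiv.symm.trans ((MvPolynomial.renameEquiv k e).trans ht.1.aevalEquiv)
  let := IsAlgClosed.isAlgClosure_of_transcendence_basis _ hs
  let := IsAlgClosed.isAlgClosure_of_transcendence_basis _ ht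
  refine ⟨IsAlgClosure.equivOfEquiv M M a.toRingEquiv, fun c => ?_, ?_⟩
  · have := IsAlgClosure.equivOfEquiv_algebraMap M M a.toRingEquiv (algebraMap k _ c)
    rw [← IsScalarTower.algebraMap_apply] at this
    rw [this]
    change algebraMap _ M (a (algebraMap k _ c)) = _
    rw [a.commutes, ← IsScalarTower.algebraMap_apply]
  · have hX : algebraMap _ M (hs.1.aevalEquiv (MvPolynomial.X ⟨x, hxs⟩)) = x := by
      rw [hs.1.algebraMap_aevalEquiv]; simp
    have := IsAlgClosure.equivOfEquiv_algebraMap M M a.toRingEquiv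
      (hs.1.aevalEquiv (MvPolynomial.X ⟨x, hxs⟩))
    rw [hX] at this
    rw [this]
    change algebraMap _ M (a (hs.1.aevalEquiv (MvPolynomial.X ⟨x, hxs⟩))) = _
    simp only [a, AlgEquiv.trans_apply, AlgEquiv.symm_apply_apply, MvPolynomial.renameEquiv_apply,
      MvPolynomial.rename_X, he]
    rw [ht.1.algebraMap_aevalEquiv]; simp

open FirstOrder FirstOrder.Language FirstOrder.Ring FirstOrder.Field in
/-- Algebraically closed fields are strongly minimal. -/
theorem IsAlgClosed.finite_or_finite_compl_setOf_realize {K : Type*} [Field K] [IsAlgClosed K]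
    [CompatibleRing K] {ι : Type*} (p : ι → K) (φ : Language.ring.Formula (ι ⊕ Unit)) :
    {t | φ.Realize (Sum.elim p fun _ => t)}.Finite ∨
      {t | φ.Realize (Sum.elim p fun _ => t)}ᶜ.Finite := by
  by_contra! h
  obtain ⟨h₁, h₂⟩ := h
  obtain ⟨q, hq⟩ := CharP.exists K
  -- Injective sequences inside the set and inside its complement define two elements of an
  -- ultrapower that are transcendental over K, hence conjugate over K; yet by Łoś's theorem the
  -- formula separates them.
  let f := Set.Infinite.natEmbedding _ h₁
  let g := Set.Infinite.natEmbedding _ h₂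
  let u := Filter.hyperfilter ℕ
  let M := (u : Filter ℕ).Product fun _ => K
  let ofSeq : (ℕ → K) → M := fun x => (x : (u : Filter ℕ).Product fun _ => K)
  have eq_iff : ∀ x y : ℕ → K, ofSeq x = ofSeq y ↔ ∀ᶠ n in (u : Filter ℕ), x n = y n :=
    fun x y => Quotient.eq''
  have : (Theory.ACF q).Model M := by
    refine (Theory.model_iff _).2 fun ψ hψ => (Ultraproduct.sentence_realize ψ).2 ?_
    exact Filter.Eventually.of_forall fun _ => Theory.realize_sentence_of_mem (Theory.ACF q) hψ
  let := fieldOfModelACF q M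
  have := modelField_of_modelACF q M
  let := compatibleRingOfModelField M
  have := isAlgClosed_of_model_ACF q M
  -- The field structure of M comes from its being a model of ACF, so its agreement with pointwise
  -- operations has to be read off from the realization of terms.
  have cast : ∀ (t : Language.ring.Term Bool) (x y : ℕ → K),
      t.realize (fun i => bif i then ofSeq x else ofSeq y) =
        ofSeq fun n => t.realize fun i => bif i then x n else y n := fun t x y => by
    have := Ultraproduct.term_realize_cast (M := fun _ => K) (u := u)
      (fun (i : Bool) n => bif i then x n else y n) t
    refine Eq.trans ?_ this
    congr 1
    funext i
    cases i <;> rfl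
  let c : K →+* M :=
    { toFun := fun a => ofSeq fun _ => a
      map_zero' := by simpa using (cast 0 0 0).symm
      map_one' := by simpa using (cast 1 0 0).symm
      map_add' := fun a b => by
        have h := cast (Term.var true + Term.var false) (fun _ => a) fun _ => b
        rw [realize_add] at h
        refine Eq.trans ?_ h.symm
        congr 1; funext n; exact (realize_add (.var true) (.var false) (fun i => bif i then a else b)).symm
      map_mul' := fun a b => by
        have h := cast (Term.var true * Term.var false) (fun _ => a) fun _ => b
        rw [realize_mul] at h
        refine Eq.trans ?_ h.symm
        congr 1; funext n; exact (realize_mul (.var true) (.var false) (fun i => bif i then a else b)).symm }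
  let : Algebra K M := c.toAlgebra
  -- K is algebraically closed, so an algebraic element of M is a constant a; an injective sequence
  -- equals a at most once.
  have trans : ∀ x : ℕ → K, Function.Injective x → Transcendental K (ofSeq x) := by
    intro x hx halg
    obtain ⟨a, ha⟩ := minpoly.mem_range_of_degree_eq_one K (ofSeq x)
      (IsAlgClosed.degree_eq_one_of_irreducible K (minpoly.irreducible halg.isIntegral))
    have h := (eq_iff (fun _ => a) x).1 ha
    have hfin : {n | a = x n}.Finite :=
      Set.Subsingleton.finite fun m hm n hn => hx (hm.symm.trans hn)
    exact Filter.notMem_hyperfilter_of_finite hfin h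
  obtain ⟨σ, hσ, hσx⟩ := IsAlgClosed.exists_ringEquiv_apply_eq_of_transcendental
    (trans _ (Subtype.val_injective.comp f.injective))
    (trans _ (Subtype.val_injective.comp g.injective))
  have los : ∀ x : ℕ → K, φ.Realize (Sum.elim (fun i => c (p i)) fun _ => ofSeq x) ↔
      ∀ᶠ n in (u : Filter ℕ), φ.Realize (Sum.elim p fun _ => x n) := fun x => by
    have := Ultraproduct.realize_formula_cast (M := fun _ => K) (u := u) φ
      (Sum.elim (fun i _ => p i) fun _ => x)
    have h₅ : (Sum.elim (fun i => c (p i)) fun _ => ofSeq x : ι ⊕ Unit → M) =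
        fun i => ofSeq (Sum.elim (fun i _ => p i) (fun _ => x) i) := by
      funext i; cases i <;> rfl
    have h₆ : ∀ n, (Sum.elim p fun _ => x n : ι ⊕ Unit → K) =
        fun i => (Sum.elim (fun i _ => p i) (fun _ => x) i : ℕ → K) n := fun n => by
      funext i; cases i <;> rfl
    simp only [h₅, h₆]
    exact this
  have h₃ := (los (Subtype.val ∘ f)).2 (.of_forall fun n => (f n).2)
  have h₄ : ¬ _ := fun h => ((los (Subtype.val ∘ g)).1 h).exists.elim fun n hn => (g n).2 hn
  refine h₄ ?_
  let τ := languageEquivEquivRingEquiv.symm σ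
  rw [← hσx]
  have h₅ := (StrongHomClass.realize_formula τ φ).2 h₃
  convert h₅ using 1
  funext i
  cases i
  · exact (hσ _).symm
  · rfl

namespace SingularSemigroup

open Matrix

theorem mk_lt_continuum_of_finite {α : Type} {s : Set α} (hs : s.Finite) : #s < 𝔠 :=
  (lt_aleph0_iff_set_finite.2 hs).trans aleph0_lt_continuum

/-! ### Definable sets of matrices. -/

section Definable

theorem IsDefinable.inter {X Y : Set M2} (hX : IsDefinable X) (hY : IsDefinable Y) :
    IsDefinable (X ∩ Y) :=
  let := FirstOrder.Ring.compatibleRingOfRing ℂ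
  Set.Definable.inter hX hY

theorem IsDefinable.union {X Y : Set M2} (hX : IsDefinable X) (hY : IsDefinable Y) :
    IsDefinable (X ∪ Y) :=
  let := FirstOrder.Ring.compatibleRingOfRing ℂ
  Set.Definable.union hX hY

theorem IsDefinable.compl {X : Set M2} (hX : IsDefinable X) : IsDefinable Xᶜ :=
  let := FirstOrder.Ring.compatibleRingOfRing ℂ
  Set.Definable.compl hX

theorem isDefinable_empty : IsDefinable ∅ :=
  let := FirstOrder.Ring.compatibleRingOfRing ℂ
  Set.definable_empty

theorem IsDefinable.biUnion {ι : Type*} {s : Set ι} (hs : s.Finite) {f : ι → Set M2}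
    (hf : ∀ i ∈ s, IsDefinable (f i)) : IsDefinable (⋃ i ∈ s, f i) := by
  induction s, hs using Set.Finite.induction_on with
  | empty => simpa using isDefinable_empty
  | insert _ _ ih =>
    rw [Set.biUnion_insert]
    exact (hf _ (Set.mem_insert _ _)).union (ih fun i hi => hf i (Set.mem_insert_of_mem _ hi))

theorem IsDefinable.biInter {ι : Type*} {s : Set ι} (hs : s.Finite) {f : ι → Set M2}
    (hf : ∀ i ∈ s, IsDefinable (f i)) : IsDefinable (⋂ i ∈ s, f i) := by
  have := (IsDefinable.biUnion hs fun i hi => (hf i hi).compl).compl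
  simpa using this

theorem isDefinable_eval_eq_zero (P : MvPolynomial (Fin 2 × Fin 2) ℂ) :
    IsDefinable {x | MvPolynomial.eval (fun i => x i.1 i.2) P = 0} := by
  let := FirstOrder.Ring.compatibleRingOfRing ℂ
  have := (FirstOrder.Ring.mvPolynomial_zeroLocus_definable {P}).mono (Set.subset_univ _)
  unfold IsDefinable
  convert this
  ext a
  simp [MvPolynomial.zeroLocus_span, MvPolynomial.aeval_eq_eval]

theorem isDefinable_affine (a b c d e : ℂ) :
    IsDefinable {x | a * x 0 0 + b * x 0 1 + c * x 1 0 + d * x 1 1 = e} := by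
  convert isDefinable_eval_eq_zero (.C a * .X (0, 0) + .C b * .X (0, 1) + .C c * .X (1, 0) +
    .C d * .X (1, 1) - .C e) using 3
  simp [sub_eq_zero]

theorem isDefinable_det : IsDefinable {x | x.det = 0} := by
  convert isDefinable_eval_eq_zero (.X (0, 0) * .X (1, 1) - .X (0, 1) * .X (1, 0)) using 3
  simp [Matrix.det_fin_two]

theorem isDefinable_vecMul (w v : Fin 2 → ℂ) : IsDefinable {x | w ᵥ* x = v} := by
  convert (isDefinable_affine (w 0) 0 (w 1) 0 (v 0)).inter
    (isDefinable_affine 0 (w 0) 0 (w 1) (v 1)) using 1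
  ext x
  simp [funext_iff, Fin.forall_fin_two, vecMul, dotProduct, Fin.sum_univ_two]

theorem isDefinable_mulVec (w v : Fin 2 → ℂ) : IsDefinable {x | x *ᵥ w = v} := by
  convert (isDefinable_affine (w 0) (w 1) 0 0 (v 0)).inter
    (isDefinable_affine 0 0 (w 0) (w 1) (v 1)) using 1
  ext x
  simp [funext_iff, Fin.forall_fin_two, mul_comm]

theorem isDefinable_singleton (m : M2) : IsDefinable {m} := by
  convert ((isDefinable_affine 1 0 0 0 (m 0 0)).inter (isDefinable_affine 0 1 0 0 (m 0 1))).inter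
    ((isDefinable_affine 0 0 1 0 (m 1 0)).inter (isDefinable_affine 0 0 0 1 (m 1 1))) using 1
  ext x
  simp [← Matrix.ext_iff, Fin.forall_fin_two]

theorem isDefinable_of_finite {X : Set M2} (hX : X.Finite) : IsDefinable X := by
  simpa using IsDefinable.biUnion hX fun m _ => isDefinable_singleton m

theorem IsDefinable.preimage_transpose {X : Set M2} (hX : IsDefinable X) :
    IsDefinable (transpose ⁻¹' X) :=
  let := FirstOrder.Ring.compatibleRingOfRing ℂ
  Set.Definable.preimage_comp (Prod.swap : Fin 2 × Fin 2 → _) hX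

-- The entries of m + t n are terms in t with parameters; substituting them into a defining formula
-- reduces the claim to strong minimality.
open FirstOrder FirstOrder.Language FirstOrder.Ring in
theorem IsDefinable.finite_or_finite_compl_line {X : Set M2} (hX : IsDefinable X) (m n : M2) :
    {t : ℂ | m + t • n ∈ X}.Finite ∨ {t : ℂ | m + t • n ∈ X}ᶜ.Finite := by
  let := compatibleRingOfRing ℂ
  obtain ⟨φ, hφ⟩ := Set.definable_iff_exists_formula_sum.1 hX
  let ψ : Language.ring.Formula (ℂ ⊕ Unit) := BoundedFormula.subst φ (Sum.elim
    (fun c => Term.var (.inl c.1))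
    fun i => Term.var (.inl (m i.1 i.2)) + Term.var (.inr ()) * Term.var (.inl (n i.1 i.2)))
  have key : {t : ℂ | m + t • n ∈ X} = {t | ψ.Realize (Sum.elim id fun _ => t)} := by
    ext t
    have h := Set.ext_iff.1 hφ fun i => (m + t • n) i.1 i.2
    refine Iff.trans h ?_
    simp only [ψ, Formula.Realize, BoundedFormula.realize_subst, Set.mem_ofPred_eq]
    refine iff_of_eq ?_
    congr 1
    funext i
    rcases i with i | i
    · rfl
    · simp
  rw [key]
  exact IsAlgClosed.finite_or_finite_compl_setOf_realize id ψ

end Definable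

/-! ### Small intersections of definable sets and semigroups. -/

/-- A set is finite or has a complement of cardinality less than the continuum. -/
def FiniteOrCosmall {α : Type} (X : Set α) : Prop := X.Finite ∨ #↥Xᶜ < 𝔠

theorem FiniteOrCosmall.preimage {α β : Type} {X : Set β} (hX : FiniteOrCosmall X) {f : α → β}
    (hf : f.Injective) : FiniteOrCosmall (f ⁻¹' X) :=
  hX.imp (fun h => h.preimage hf.injOn) fun h =>
    (mk_le_of_injective (Set.restrictPreimage_injective Xᶜ hf)).trans_lt h

/-- Either one member of the family already meets the line in a finite set, or each omits only
finitely many points, and fewer than continuum many finite sets have a union smaller than the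
continuum. -/
theorem IsInftyDefinable.finiteOrCosmall_line {X : Set M2} (hX : IsInftyDefinable X) (m n : M2) :
    FiniteOrCosmall {t : ℂ | m + t • n ∈ X} := by
  obtain ⟨D, hD, hdef, rfl⟩ := hX
  by_cases h : ∃ Y ∈ D, {t : ℂ | m + t • n ∈ Y}.Finite
  · obtain ⟨Y, hY, hfin⟩ := h
    exact Or.inl (hfin.subset fun t ht => ht Y hY)
  · push Not at h
    right
    have : {t : ℂ | m + t • n ∈ ⋂₀ D}ᶜ = ⋃ Y : D, {t : ℂ | m + t • n ∈ Y.1}ᶜ := by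
      ext t; simp
    rw [this]
    refine (mk_iUnion_le _).trans_lt (mul_lt_of_lt aleph0_le_continuum hD ?_)
    refine lt_of_le_of_lt (ciSup_le' fun Y => ?_) aleph0_lt_continuum
    exact (lt_aleph0_iff_set_finite.2 <|
      ((hdef _ Y.2).finite_or_finite_compl_line m n).resolve_left (h Y.1 Y.2)).le

theorem IsInftyDefinable.preimage_transpose {X : Set M2} (hX : IsInftyDefinable X) :
    IsInftyDefinable (transpose ⁻¹' X) := by
  obtain ⟨D, hD, hdef, rfl⟩ := hX
  refine ⟨(fun Y => transpose ⁻¹' Y) '' D, mk_image_le.trans_lt hD, ?_, ?_⟩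
  · rintro _ ⟨Y, hY, rfl⟩
    exact (hdef Y hY).preimage_transpose
  · ext x; simp

/-- The subsemigroup of the transposes of the elements of a subsemigroup. -/
def transposed (S : Subsemigroup M2) : Subsemigroup M2 where
  carrier := transpose ⁻¹' S
  mul_mem' {x y} hx hy := by
    simp only [Set.mem_preimage, SetLike.mem_coe, transpose_mul] at *
    exact S.mul_mem hy hx

@[simp]
theorem mem_transposed {S : Subsemigroup M2} {x : M2} : x ∈ transposed S ↔ xᵀ ∈ S := Iff.rfl

theorem IsInterOfDefinableSemigroups.of_isDefinable {T : Subsemigroup M2}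
    (hT : IsDefinable (T : Set M2)) (hsing : ∀ x ∈ T, x.det = 0) :
    IsInterOfDefinableSemigroups (T : Set M2) :=
  ⟨{T}, mk_lt_continuum_of_finite (Set.finite_singleton _), by simpa using ⟨hT, hsing⟩, by simp⟩

theorem IsInterOfDefinableSemigroups.iInter {ι : Type} (hι : #ι < 𝔠) [Nonempty ι]
    {X : ι → Set M2} (hX : ∀ i, ∃ T : Subsemigroup M2, IsDefinable (T : Set M2) ∧
      (∀ x ∈ T, x.det = 0) ∧ X i = T) : IsInterOfDefinableSemigroups (⋂ i, X i) := by
  choose T hT hsing hXT using hX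
  refine ⟨Set.range T, mk_range_le.trans_lt hι, ?_, ?_⟩
  · rintro _ ⟨i, rfl⟩
    exact ⟨hT i, hsing i⟩
  · simp [hXT]

theorem IsInterOfDefinableSemigroups.inter {X Y : Set M2} (hX : IsInterOfDefinableSemigroups X)
    (hY : IsInterOfDefinableSemigroups Y) : IsInterOfDefinableSemigroups (X ∩ Y) := by
  obtain ⟨D, hD, hdef, rfl⟩ := hX
  obtain ⟨E, hE, hdef', rfl⟩ := hY
  refine ⟨D ∪ E, (mk_union_le _ _).trans_lt (add_lt_of_lt aleph0_le_continuum hD hE), ?_, ?_⟩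
  · rintro T (h | h)
    exacts [hdef T h, hdef' T h]
  · rw [Set.biInter_union]

theorem IsInterOfDefinableSemigroups.preimage_transpose {X : Set M2}
    (hX : IsInterOfDefinableSemigroups X) :
    IsInterOfDefinableSemigroups (transpose ⁻¹' X) := by
  obtain ⟨D, hD, hdef, rfl⟩ := hX
  refine ⟨transposed '' D, mk_image_le.trans_lt hD, ?_, ?_⟩
  · rintro _ ⟨T, hT, rfl⟩
    exact ⟨(hdef T hT).1.preimage_transpose, fun x hx => by
      simpa using (hdef T hT).2 _ hx⟩
  · ext x; simp

/-! ### Rank one matrices as products p qᵀ. -/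

section Vectors

/-- The vector orthogonal to `q` for the standard bilinear form. -/
def perp (q : Fin 2 → ℂ) : Fin 2 → ℂ := ![q 1, -q 0]

@[simp] theorem perp_perp (q : Fin 2 → ℂ) : perp (perp q) = -q := by
  ext i; fin_cases i <;> simp [perp]

@[simp] theorem perp_smul (c : ℂ) (q : Fin 2 → ℂ) : perp (c • q) = c • perp q := by
  ext i; fin_cases i <;> simp [perp]

@[simp] theorem perp_eq_zero {q : Fin 2 → ℂ} : perp q = 0 ↔ q = 0 := by
  simp [perp, funext_iff, Fin.forall_fin_two, and_comm]

@[simp] theorem perp_dotProduct_self (q : Fin 2 → ℂ) : perp q ⬝ᵥ q = 0 := by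
  simp [perp, dotProduct, Fin.sum_univ_two]; ring

@[simp] theorem dotProduct_perp_self (q : Fin 2 → ℂ) : q ⬝ᵥ perp q = 0 := by
  rw [dotProduct_comm, perp_dotProduct_self]

theorem perp_dotProduct_comm (p q : Fin 2 → ℂ) : perp p ⬝ᵥ q = -(perp q ⬝ᵥ p) := by
  simp [perp, dotProduct, Fin.sum_univ_two]; ring

theorem exists_eq_smul_perp {w p : Fin 2 → ℂ} (hw : w ≠ 0) (h : w ⬝ᵥ p = 0) :
    ∃ c : ℂ, p = c • perp w := by
  simp only [dotProduct, Fin.sum_univ_two] at h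
  by_cases h1 : w 1 = 0
  · have h0 : w 0 ≠ 0 := fun h0 => hw (by ext i; fin_cases i <;> simp [h0, h1])
    refine ⟨-p 1 / w 0, ?_⟩
    ext i; fin_cases i
    · simpa [perp, h1, h0] using h
    · simp [perp]; field_simp
  · refine ⟨p 0 / w 1, ?_⟩
    ext i; fin_cases i
    · simp [perp]; field_simp
    · simp [perp]; field_simp; linear_combination h

theorem exists_eq_smul_of_dotProduct_eq_zero {w p p' : Fin 2 → ℂ} (hw : w ≠ 0) (hp : p ≠ 0)
    (hp' : p' ≠ 0) (h : w ⬝ᵥ p = 0) (h' : w ⬝ᵥ p' = 0) : ∃ c : ℂ, c ≠ 0 ∧ p' = c • p := by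
  obtain ⟨a, rfl⟩ := exists_eq_smul_perp hw h
  obtain ⟨b, rfl⟩ := exists_eq_smul_perp hw h'
  have ha : a ≠ 0 := fun h => hp (by simp [h])
  have hb : b ≠ 0 := fun h => hp' (by simp [h])
  exact ⟨b / a, div_ne_zero hb ha, by rw [smul_smul, div_mul_cancel₀ _ ha]⟩

theorem exists_dotProduct_ne_zero {p : Fin 2 → ℂ} (hp : p ≠ 0) : ∃ q, q ⬝ᵥ p ≠ 0 := by
  by_contra! h
  exact hp (dotProduct_eq_zero_iff.1 fun q => by rw [dotProduct_comm]; exact h q)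

theorem exists_eq_vecMulVec {x : M2} (hx : x.det = 0) : ∃ p q, x = vecMulVec p q := by
  rw [det_fin_two] at hx
  by_cases h : x 0 = 0
  · refine ⟨![0, 1], x 1, ?_⟩
    ext i j
    fin_cases i
    · simp [vecMulVec_apply, h]
    · simp [vecMulVec_apply]
  · have hw : perp (x 0) ⬝ᵥ x 1 = 0 := by
      simp [perp, dotProduct, Fin.sum_univ_two]; linear_combination -hx
    obtain ⟨c, hc⟩ := exists_eq_smul_perp (by simpa using h) hw
    refine ⟨![1, -c], x 0, ?_⟩
    ext i j
    fin_cases i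
    · simp [vecMulVec_apply]
    · simp [vecMulVec_apply, hc]

theorem vecMulVec_ne_zero_iff {p q : Fin 2 → ℂ} : vecMulVec p q ≠ 0 ↔ p ≠ 0 ∧ q ≠ 0 := by
  simp

theorem eq_smul_of_vecMulVec_eq {p q p' q' : Fin 2 → ℂ} (h : vecMulVec p q = vecMulVec p' q')
    (hp : p ≠ 0) (hq : q ≠ 0) : ∃ c : ℂ, c ≠ 0 ∧ p' = c • p ∧ q = c • q' := by
  have h0 : vecMulVec p' q' ≠ 0 := h ▸ vecMulVec_ne_zero_iff.2 ⟨hp, hq⟩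
  obtain ⟨hp', hq'⟩ := vecMulVec_ne_zero_iff.1 h0
  have h1 : perp p ⬝ᵥ p' = 0 := by
    have := congrArg (fun x => perp p ᵥ* x) h
    simp only [vecMul_vecMulVec, perp_dotProduct_self, zero_smul] at this
    exact (smul_eq_zero.1 this.symm).resolve_right hq'
  obtain ⟨c, hc, rfl⟩ := exists_eq_smul_of_dotProduct_eq_zero (by simpa using hp) hp hp'
    (perp_dotProduct_self p) h1
  refine ⟨c, hc, rfl, ?_⟩
  rw [smul_vecMulVec, ← vecMulVec_smul, ← sub_eq_zero, ← vecMulVec_sub, vecMulVec_eq_zero] at h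
  exact sub_eq_zero.1 (h.resolve_left hp)

end Vectors

/-! ### From B_{F,G} to cones of vectors. -/

section Projective

/-- The nonzero vectors representing the points of a subset of the projective line. -/
def cone (F : Set CP1) : Set (Fin 2 → ℂ) := {p | ∃ h : p ≠ 0, Projectivization.mk ℂ p h ∈ F}

theorem smul_mem_cone {F : Set CP1} {p : Fin 2 → ℂ} (hp : p ∈ cone F) {c : ℂ} (hc : c ≠ 0) :
    c • p ∈ cone F := by
  obtain ⟨h, hF⟩ := hp
  refine ⟨smul_ne_zero hc h, ?_⟩
  convert hF using 1
  exact (Projectivization.mk_eq_mk_iff' _ _ _ _ _).2 ⟨c, rfl⟩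

theorem exists_mem_cone_of_one_lt_encard {F : Set CP1} (hF : 1 < F.encard) :
    ∃ p ∈ cone F, ∃ p' ∈ cone F, perp p ⬝ᵥ p' ≠ 0 := by
  obtain ⟨v, w, hv, hw, hne⟩ := Set.one_lt_encard_iff.1 hF
  refine ⟨v.rep, ⟨v.rep_nonzero, by simpa⟩, w.rep, ⟨w.rep_nonzero, by simpa⟩, fun h => hne ?_⟩
  obtain ⟨c, -, hc⟩ := exists_eq_smul_of_dotProduct_eq_zero (by simpa using v.rep_nonzero)
    v.rep_nonzero w.rep_nonzero (perp_dotProduct_self _) h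
  rw [← v.mk_rep, ← w.mk_rep, eq_comm]
  exact (Projectivization.mk_eq_mk_iff' _ _ _ _ _).2 ⟨c, hc.symm⟩

theorem exists_mem_cone_of_encard_eq_one {F : Set CP1} (hF : F.encard = 1) :
    ∃ p ∈ cone F, ∀ p' ∈ cone F, perp p ⬝ᵥ p' = 0 := by
  obtain ⟨v, rfl⟩ := Set.encard_eq_one.1 hF
  refine ⟨v.rep, ⟨v.rep_nonzero, by simp⟩, ?_⟩
  rintro p' ⟨hp', h⟩
  rw [Set.mem_singleton_iff, ← v.mk_rep] at h
  obtain ⟨c, hc⟩ := (Projectivization.mk_eq_mk_iff' _ _ _ hp' v.rep_nonzero).1 h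
  rw [← hc, dotProduct_smul, perp_dotProduct_self, smul_zero]

/-- The nonzero linear forms whose kernel belongs to a subset of the projective line. -/
def dualCone (G : Set CP1) : Set (Fin 2 → ℂ) := {q | perp q ∈ cone G}

theorem perp_mem_dualCone {G : Set CP1} {p : Fin 2 → ℂ} (hp : p ∈ cone G) :
    perp p ∈ dualCone G := by
  simpa [dualCone] using smul_mem_cone hp (c := -1) (by simp)

theorem exists_mem_dualCone_of_one_lt_encard {G : Set CP1} (hG : 1 < G.encard) :
    ∃ q ∈ dualCone G, ∃ q' ∈ dualCone G, perp q ⬝ᵥ q' ≠ 0 := by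
  obtain ⟨p, hp, p', hp', h⟩ := exists_mem_cone_of_one_lt_encard hG
  refine ⟨_, perp_mem_dualCone hp, _, perp_mem_dualCone hp', ?_⟩
  rw [perp_dotProduct_comm]
  simpa [dotProduct_comm] using h

theorem exists_mem_dualCone_of_encard_eq_one {G : Set CP1} (hG : G.encard = 1) :
    ∃ q ∈ dualCone G, ∀ q' ∈ dualCone G, perp q ⬝ᵥ q' = 0 := by
  obtain ⟨p, hp, h⟩ := exists_mem_cone_of_encard_eq_one hG
  refine ⟨_, perp_mem_dualCone hp, fun q' hq' => ?_⟩
  rw [perp_dotProduct_comm, neg_eq_zero, dotProduct_comm]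
  exact h _ hq'

theorem hasImageKernel_vecMulVec {p q : Fin 2 → ℂ} (hp : p ≠ 0) (hq : q ≠ 0) :
    HasImageKernel (vecMulVec p q) (.mk ℂ p hp) (.mk ℂ (perp q) (by simpa using hq)) := by
  constructor
  · ext y
    simp only [LinearMap.mem_range, mulVecLin_apply, vecMulVec_mulVec,
      Projectivization.submodule_mk, Submodule.mem_span_singleton, op_smul_eq_smul]
    constructor
    · rintro ⟨z, rfl⟩; exact ⟨_, rfl⟩
    · rintro ⟨c, rfl⟩
      obtain ⟨z, hz⟩ := exists_dotProduct_ne_zero hq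
      refine ⟨(c / (z ⬝ᵥ q)) • z, ?_⟩
      rw [dotProduct_comm, smul_dotProduct, smul_eq_mul, div_mul_cancel₀ _ hz]
  · ext z
    simp only [LinearMap.mem_ker, mulVecLin_apply, vecMulVec_mulVec,
      Projectivization.submodule_mk, Submodule.mem_span_singleton, op_smul_eq_smul,
      smul_eq_zero, hp, or_false]
    constructor
    · intro h
      obtain ⟨c, hc⟩ := exists_eq_smul_perp hq h
      exact ⟨c, hc.symm⟩
    · rintro ⟨c, rfl⟩
      rw [dotProduct_smul, dotProduct_perp_self, smul_zero]

theorem HasImageKernel.exists_vecMulVec {x : M2} {v u : CP1} (h : HasImageKernel x v u) :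
    ∃ p q, ∃ (hp : p ≠ 0) (hq : perp q ≠ 0), x = vecMulVec p q ∧ Projectivization.mk ℂ p hp = v ∧
      Projectivization.mk ℂ (perp q) hq = u := by
  have hdet : x.det = 0 := by
    by_contra hne
    have : LinearMap.ker x.mulVecLin = ⊥ := ker_mulVecLin_eq_bot_iff.2 fun z hz =>
      eq_zero_of_mulVec_eq_zero hne hz
    rw [h.2] at this
    have hf := u.finrank_submodule
    rw [this] at hf
    simp at hf
  obtain ⟨p, q, rfl⟩ := exists_eq_vecMulVec hdet
  have h0 : vecMulVec p q ≠ 0 := fun h0 => by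
    have h1 := h.1
    have hf := v.finrank_submodule
    rw [← h1, h0, mulVecLin_zero, LinearMap.range_zero] at hf
    simp at hf
  obtain ⟨hp, hq⟩ := vecMulVec_ne_zero_iff.1 h0
  have h' := hasImageKernel_vecMulVec hp hq
  exact ⟨p, q, hp, by simpa using hq, rfl, Projectivization.submodule_injective (h'.1.symm.trans h.1),
    Projectivization.submodule_injective (h'.2.symm.trans h.2)⟩

theorem proj_eq_proj_iff {x y : M2} : proj x = proj y ↔ ∃ z : ℂˣ, z • y = x :=
  Quotient.eq''

theorem proj_eq_proj_zero_iff {x : M2} : proj x = proj 0 ↔ x = 0 := by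
  simp [proj_eq_proj_iff, eq_comm]

theorem proj_mem_B_iff {F G : Set CP1} {x : M2} :
    proj x ∈ B F G ↔ x = 0 ∨ ∃ p ∈ cone F, ∃ q ∈ dualCone G, x = vecMulVec p q := by
  constructor
  · rintro (h | ⟨y, hy, v, hv, u, hu, h⟩)
    · exact Or.inl (proj_eq_proj_zero_iff.1 h)
    · right
      obtain ⟨z, rfl⟩ := proj_eq_proj_iff.1 hy
      obtain ⟨p, q, hp, hq, rfl, rfl, rfl⟩ := h.exists_vecMulVec
      refine ⟨_, smul_mem_cone ⟨hp, hv⟩ z.ne_zero, q, ⟨hq, hu⟩, ?_⟩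
      rw [smul_vecMulVec]; rfl
  · rintro (rfl | ⟨p, ⟨hp, hF⟩, q, ⟨hq, hG⟩, rfl⟩)
    · exact Or.inl rfl
    · exact Or.inr ⟨_, rfl, _, hF, _, hG, hasImageKernel_vecMulVec hp (by simpa using hq)⟩

end Projective

/-! ### Multiplicities of idempotents. -/

/-- A multiplicatively closed nonempty subset of `ℂˣ` that is finite or has a small complement is
a finite subgroup or everything. -/
theorem exists_subgroup_of_finiteOrCosmall {Z : Set ℂˣ} (hZ : FiniteOrCosmall Z)
    (hne : Z.Nonempty) (hmul : ∀ a ∈ Z, ∀ b ∈ Z, a * b ∈ Z) :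
    ∃ H : Subgroup ℂˣ, (H : Set ℂˣ) = Z ∧ (Z.Finite ∨ Z = Set.univ) := by
  rcases hZ with hfin | hsmall
  -- Multiplication by a is injective on the finite set Z, hence surjective.
  · have hsurj : ∀ a ∈ Z, ∀ b ∈ Z, ∃ c ∈ Z, a * c = b := fun a ha b hb => by
      have : (a * ·) '' Z = Z := by
        refine Set.eq_of_subset_of_ncard_le (Set.image_subset_iff.2 fun c hc => hmul a ha c hc) ?_
          hfin
        rw [Set.ncard_image_of_injective _ (mul_right_injective a)]
      exact this.ge hb
    obtain ⟨a, ha⟩ := hne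
    have h1 : (1 : ℂˣ) ∈ Z := by
      obtain ⟨c, hc, h⟩ := hsurj a ha a ha
      rwa [← mul_eq_left.1 h]
    refine ⟨{ carrier := Z, mul_mem' := fun hx hy => hmul _ hx _ hy, one_mem' := h1,
              inv_mem' := fun {x} hx => ?_ }, rfl, Or.inl hfin⟩
    obtain ⟨c, hc, h⟩ := hsurj x hx 1 h1
    rwa [← eq_inv_of_mul_eq_one_right h]
  · have huniv : Z = Set.univ := by
      -- Write z = w (w⁻¹ z): fewer than continuum many w fail to have both factors in Z.
      refine Set.eq_univ_of_forall fun z => ?_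
      have hlt : #↥(Zᶜ ∪ (fun w => z * w⁻¹) '' Zᶜ) < #ℂˣ := by
        have hc : #ℂˣ = 𝔠 := by
          rw [← mk_complex, mk_congr (unitsEquivNeZero (G₀ := ℂ))]
          exact mk_compl_of_infinite {(0 : ℂ)}
            ((mk_singleton _).trans_lt (one_lt_aleph0.trans_le (aleph0_le_mk ℂ)))
        rw [hc]
        exact (mk_union_le _ _).trans_lt
          (add_lt_of_lt aleph0_le_continuum hsmall (mk_image_le.trans_lt hsmall))
      obtain ⟨w, hw⟩ : ∃ w, w ∉ Zᶜ ∪ (fun w => z * w⁻¹) '' Zᶜ := by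
        by_contra! h
        rw [Set.eq_univ_of_forall h, mk_univ] at hlt
        exact hlt.ne rfl
      simp only [Set.mem_union, Set.mem_compl_iff, not_or, not_not, Set.mem_image, not_exists,
        not_and] at hw
      have h2 : w⁻¹ * z ∈ Z := by
        by_contra h
        exact hw.2 _ h (by simp)
      simpa using hmul _ hw.1 _ h2
    exact ⟨⊤, by simp [huniv], Or.inr huniv⟩

theorem IsInftyDefinable.finiteOrCosmall_mult {X : Set M2} (hX : IsInftyDefinable X) (x : M2) :
    FiniteOrCosmall (mult X x) := by
  have := (hX.finiteOrCosmall_line 0 x).preimage Units.val_injective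
  simp only [zero_add] at this
  exact this

theorem exists_subgroup_mult {S : Subsemigroup M2} (hdef : IsInftyDefinable (S : Set M2))
    {e : M2} (he : e * e = e) {z : ℂˣ} (hz : z • e ∈ S) :
    ∃ H : Subgroup ℂˣ, (H : Set ℂˣ) = mult S e ∧
      ((mult S e).Finite ∨ mult S e = Set.univ) := by
  refine exists_subgroup_of_finiteOrCosmall (hdef.finiteOrCosmall_mult e) ⟨z, hz⟩ ?_
  intro a ha b hb
  have := S.mul_mem ha hb
  rwa [smul_mul_smul_comm, he] at this

theorem mem_of_smul_mem {S : Subsemigroup M2} (hdef : IsInftyDefinable (S : Set M2))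
    {e : M2} (he : e * e = e) {z : ℂˣ} (hz : z • e ∈ S) : e ∈ S := by
  obtain ⟨H, hH, -⟩ := exists_subgroup_mult hdef he hz
  have : (1 : ℂˣ) ∈ mult S e := hH ▸ H.one_mem
  simpa [mult] using this

/-! ### Rectangular semigroups and equal multiplicity. -/

/-- The subsemigroup `S` of singular matrices is, up to scalars and zero, the set of all matrices
`p qᵀ` with `p ∈ A` and `q ∈ C`. -/
structure IsRect (S : Subsemigroup M2) (A C : Set (Fin 2 → ℂ)) : Prop where
  zero_notMem_left : 0 ∉ A
  zero_notMem_right : 0 ∉ C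
  smul_left : ∀ p ∈ A, ∀ c : ℂ, c ≠ 0 → c • p ∈ A
  smul_right : ∀ q ∈ C, ∀ c : ℂ, c ≠ 0 → c • q ∈ C
  exists_vecMulVec : ∀ x ∈ S, x ≠ 0 → ∃ p ∈ A, ∃ q ∈ C, x = vecMulVec p q
  exists_smul_mem : ∀ p ∈ A, ∀ q ∈ C, ∃ z : ℂˣ, z • vecMulVec p q ∈ S

/-- Both forms of the hypothesis give the same structure, because `IsRect` says nothing about
whether 0 lies in S. -/
theorem isRect_of_image_proj {S : Subsemigroup M2} {F G : Set CP1}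
    (hS : proj '' (S : Set M2) = B F G ∨ proj '' (S : Set M2) = B F G \ {proj 0}) :
    IsRect S (cone F) (dualCone G) where
  zero_notMem_left := fun ⟨h, _⟩ => h rfl
  zero_notMem_right := fun ⟨h, _⟩ => h (by simp)
  smul_left _ hp _ hc := smul_mem_cone hp hc
  smul_right q hq c hc := by
    change perp (c • q) ∈ cone G
    rw [perp_smul]
    exact smul_mem_cone hq hc
  exists_vecMulVec x hx h0 := by
    have h : proj x ∈ proj '' (S : Set M2) := ⟨x, hx, rfl⟩
    have hB : proj x ∈ B F G := by
      rcases hS with hS | hS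
      · rwa [hS] at h
      · rw [hS] at h; exact h.1
    exact (proj_mem_B_iff.1 hB).resolve_left h0
  exists_smul_mem p hp q hq := by
    have hB : proj (vecMulVec p q) ∈ B F G := proj_mem_B_iff.2 (Or.inr ⟨p, hp, q, hq, rfl⟩)
    have hne : vecMulVec p q ≠ 0 :=
      vecMulVec_ne_zero_iff.2 ⟨hp.1, by simpa using hq.1⟩
    have h : proj (vecMulVec p q) ∈ proj '' (S : Set M2) := by
      rcases hS with hS | hS
      · rwa [hS]
      · rw [hS]; exact ⟨hB, fun h => hne (proj_eq_proj_zero_iff.1 h)⟩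
    obtain ⟨s, hs, hsp⟩ := h
    obtain ⟨z, rfl⟩ := proj_eq_proj_iff.1 hsp
    exact ⟨z, hs⟩

namespace IsRect

variable {S : Subsemigroup M2} {A C : Set (Fin 2 → ℂ)}

theorem transposed (h : IsRect S A C) : IsRect (transposed S) C A where
  zero_notMem_left := h.zero_notMem_right
  zero_notMem_right := h.zero_notMem_left
  smul_left := h.smul_right
  smul_right := h.smul_left
  exists_vecMulVec x hx h0 := by
    obtain ⟨p, hp, q, hq, hpq⟩ := h.exists_vecMulVec xᵀ hx (by simpa using h0)
    exact ⟨q, hq, p, hp, by rw [← transpose_transpose x, hpq, transpose_vecMulVec]⟩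
  exists_smul_mem p hp q hq := by
    obtain ⟨z, hz⟩ := h.exists_smul_mem q hq p hp
    exact ⟨z, by rwa [mem_transposed, transpose_smul, transpose_vecMulVec]⟩

theorem ne_zero_left (h : IsRect S A C) {p : Fin 2 → ℂ} (hp : p ∈ A) : p ≠ 0 :=
  fun h0 => h.zero_notMem_left (h0 ▸ hp)

theorem ne_zero_right (h : IsRect S A C) {q : Fin 2 → ℂ} (hq : q ∈ C) : q ≠ 0 :=
  fun h0 => h.zero_notMem_right (h0 ▸ hq)

theorem mem_left_of_dotProduct_eq_zero (h : IsRect S A C) {w p p' : Fin 2 → ℂ} (hw : w ≠ 0)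
    (hp : p ∈ A) (hp' : p' ≠ 0) (hwp : w ⬝ᵥ p = 0) (hwp' : w ⬝ᵥ p' = 0) : p' ∈ A := by
  obtain ⟨c, hc, rfl⟩ := exists_eq_smul_of_dotProduct_eq_zero hw (h.ne_zero_left hp) hp' hwp hwp'
  exact h.smul_left p hp c hc

theorem mem_of_vecMulVec_mem (h : IsRect S A C) {p q : Fin 2 → ℂ} {z : ℂˣ}
    (hx : z • vecMulVec p q ∈ S) (hp : p ≠ 0) (hq : q ≠ 0) : p ∈ A ∧ q ∈ C := by
  have hne : vecMulVec p q ≠ 0 := vecMulVec_ne_zero_iff.2 ⟨hp, hq⟩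
  obtain ⟨p', hp', q', hq', he⟩ := h.exists_vecMulVec _ hx ((smul_ne_zero_iff_ne z).2 hne)
  have he' : vecMulVec ((z : ℂ) • p) q = vecMulVec p' q' := by
    rw [smul_vecMulVec, ← he]; rfl
  obtain ⟨c, hc, rfl, rfl⟩ := eq_smul_of_vecMulVec_eq he' (smul_ne_zero z.ne_zero hp) hq
  refine ⟨?_, h.smul_right _ hq' _ hc⟩
  have := h.smul_left _ hp' (c * z)⁻¹ (inv_ne_zero (mul_ne_zero hc z.ne_zero))
  rwa [smul_smul, smul_smul, mul_assoc, inv_mul_cancel₀ (mul_ne_zero hc z.ne_zero), one_smul] at this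

theorem vecMulVec_mul_self {p q : Fin 2 → ℂ} (hqp : q ⬝ᵥ p = 1) :
    vecMulVec p q * vecMulVec p q = vecMulVec p q := by
  simp only [vecMulVec_mul_vecMulVec, hqp, one_smul]

theorem idem_mem (h : IsRect S A C) (hdef : IsInftyDefinable (S : Set M2)) {p q : Fin 2 → ℂ}
    (hp : p ∈ A) (hq : q ∈ C) (hqp : q ⬝ᵥ p = 1) : vecMulVec p q ∈ S := by
  obtain ⟨z, hz⟩ := h.exists_smul_mem p hp q hq
  exact mem_of_smul_mem hdef (vecMulVec_mul_self hqp) hz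

/-- Every image is complementary to some kernel and vice versa. -/
def Regular (A C : Set (Fin 2 → ℂ)) : Prop :=
  (∀ p ∈ A, ∃ q ∈ C, q ⬝ᵥ p ≠ 0) ∧ ∀ q ∈ C, ∃ p ∈ A, q ⬝ᵥ p ≠ 0

theorem exists_dotProduct_eq_one (h : IsRect S A C) {p : Fin 2 → ℂ}
    (hp : ∃ q ∈ C, q ⬝ᵥ p ≠ 0) : ∃ q ∈ C, q ⬝ᵥ p = 1 := by
  obtain ⟨q, hq, hqp⟩ := hp
  exact ⟨_, h.smul_right q hq _ (inv_ne_zero hqp), by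
    rw [smul_dotProduct, smul_eq_mul, inv_mul_cancel₀ hqp]⟩

/-- Regularity supplies q₁ pairing nontrivially with the column of x and p₁ pairing nontrivially
with its row; the outer factors are multiples of p' q₁ᵀ and p₁ q'ᵀ. -/
theorem exists_mul_mul_eq_smul (h : IsRect S A C) (hreg : Regular A C) {x y : M2} (hx : x ∈ S)
    (hx0 : x ≠ 0) (hy : y ∈ S) (hy0 : y ≠ 0) :
    ∃ s ∈ S, ∃ t ∈ S, ∃ c : ℂˣ, s * x * t = c • y := by
  obtain ⟨p, hp, q, hq, rfl⟩ := h.exists_vecMulVec x hx hx0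
  obtain ⟨p', hp', q', hq', rfl⟩ := h.exists_vecMulVec y hy hy0
  obtain ⟨q₁, hq₁, h₁⟩ := hreg.1 p hp
  obtain ⟨p₁, hp₁, h₂⟩ := hreg.2 q hq
  obtain ⟨a, ha⟩ := h.exists_smul_mem p' hp' q₁ hq₁
  obtain ⟨b, hb⟩ := h.exists_smul_mem p₁ hp₁ q' hq'
  refine ⟨_, ha, _, hb, a * b * Units.mk0 _ h₁ * Units.mk0 _ h₂, ?_⟩
  ext i j
  simp only [Matrix.mul_apply, Fin.sum_univ_two, Matrix.smul_apply, vecMulVec_apply,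
    Units.smul_def, smul_eq_mul, dotProduct, Units.val_mul, Units.val_mk0]
  ring

theorem exists_equal_mult (h : IsRect S A C) (hdef : IsInftyDefinable (S : Set M2))
    (hreg : Regular A C) (hA : A.Nonempty) :
    ∃ H : Subgroup ℂˣ, (∀ x ∈ S, x ≠ 0 → mult S x = H) ∧
      ((H : Set ℂˣ).Finite ∨ (H : Set ℂˣ) = Set.univ) := by
  have idem : ∀ p ∈ A, ∃ q ∈ C, q ⬝ᵥ p = 1 ∧ vecMulVec p q ∈ S := fun p hp => by
    obtain ⟨q, hq, hqp⟩ := h.exists_dotProduct_eq_one (hreg.1 p hp)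
    exact ⟨q, hq, hqp, h.idem_mem hdef hp hq hqp⟩
  have group : ∀ e ∈ S, e * e = e → ∃ H : Subgroup ℂˣ, (H : Set ℂˣ) = mult S e ∧
      ((mult S e).Finite ∨ mult S e = Set.univ) := fun e he hee =>
    exists_subgroup_mult hdef (z := 1) hee (by simpa)
  -- Moving x to c e puts c in Z_e, and moving z x puts z c there; since Z_e is a group, c cancels.
  have sub : ∀ x ∈ S, x ≠ 0 → ∀ e ∈ S, e ≠ 0 → e * e = e → mult S x ⊆ mult S e := by
    intro x hx hx0 e he he0 hee z hz
    obtain ⟨s, hs, t, ht, c, hc⟩ := h.exists_mul_mul_eq_smul hreg hx hx0 he he0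
    obtain ⟨H, hH, -⟩ := group e he hee
    have hcH : c ∈ H := by
      rw [← SetLike.mem_coe, hH]
      change c • e ∈ S
      rw [← hc]
      exact S.mul_mem (S.mul_mem hs hx) ht
    have hzc : z * c ∈ H := by
      rw [← SetLike.mem_coe, hH]
      change (z * c) • e ∈ S
      rw [mul_smul, ← hc]
      simpa using S.mul_mem (S.mul_mem hs hz) ht
    rw [← hH]
    exact (H.mul_mem_cancel_right hcH).1 hzc
  obtain ⟨p₀, hp₀⟩ := hA
  obtain ⟨q₀, hq₀, hqp₀, hS₀⟩ := idem p₀ hp₀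
  have hne₀ := vecMulVec_ne_zero_iff.2 ⟨h.ne_zero_left hp₀, h.ne_zero_right hq₀⟩
  obtain ⟨H, hH, hfin⟩ := group _ hS₀ (vecMulVec_mul_self hqp₀)
  refine ⟨H, fun x hx hx0 => ?_, hH.symm ▸ hfin⟩
  rw [hH]
  refine (sub x hx hx0 _ hS₀ hne₀ (vecMulVec_mul_self hqp₀)).antisymm fun z hz => ?_
  -- For the reverse inclusion, take an idempotent with the same image as x: it fixes x from the
  -- left, so its multiplicity acts on x.
  obtain ⟨p, hp, q, hq, rfl⟩ := h.exists_vecMulVec x hx hx0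
  obtain ⟨q₁, hq₁, hqp₁, hS₁⟩ := idem p hp
  have hne₁ := vecMulVec_ne_zero_iff.2 ⟨h.ne_zero_left hp, h.ne_zero_right hq₁⟩
  have hz' : z • vecMulVec p q₁ ∈ S :=
    sub _ hS₀ hne₀ _ hS₁ hne₁ (vecMulVec_mul_self hqp₁) hz
  have := S.mul_mem hz' hx
  rwa [smul_mul_assoc, vecMulVec_mul_vecMulVec, hqp₁, one_smul] at this

/-! ### Finite multiplicity forces finitely many lines. -/

/-- The vectors of `A` lie on finitely many lines. -/
def LineFinite (A : Set (Fin 2 → ℂ)) : Prop :=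
  ∃ R : Set (Fin 2 → ℂ), R.Finite ∧ 0 ∉ R ∧ ∀ p ∈ A, ∃ w ∈ R, w ⬝ᵥ p = 0

/-- Write e(p, q) for the idempotent proportional to p qᵀ. Then e(p, q) e(p', q') is the multiple of
e(p, q') by the cross-ratio (q ⬝ p')(q' ⬝ p) / ((q ⬝ p)(q' ⬝ p')), which must lie in Z. Fixing q,
q', p', each of its finitely many values confines p to one line. -/
theorem lineFinite_of_finite_mult (h : IsRect S A C) (hdef : IsInftyDefinable (S : Set M2))
    {Z : Set ℂˣ} (hZ : ∀ x ∈ S, x ≠ 0 → mult S x = Z) (hfin : Z.Finite) {q q' : Fin 2 → ℂ}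
    (hq : q ∈ C) (hq' : q' ∈ C) (hqq : perp q ⬝ᵥ q' ≠ 0) : LineFinite A := by
  by_cases hex : ∃ p ∈ A, q ⬝ᵥ p ≠ 0 ∧ q' ⬝ᵥ p ≠ 0
  · obtain ⟨p', hp', h₁, h₂⟩ := hex
    -- The linear form r z vanishes at p exactly when the cross-ratio is z, and it is nonzero
    -- because q and q' are independent.
    let r : ℂˣ → (Fin 2 → ℂ) := fun z => (q ⬝ᵥ p') • q' - (z * (q' ⬝ᵥ p')) • q
    refine ⟨{q, q'} ∪ r '' Z, (Set.toFinite _).union (hfin.image _), ?_, fun p hp => ?_⟩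
    · simp only [Set.mem_union, Set.mem_insert_iff, Set.mem_singleton_iff, Set.mem_image, not_or]
      refine ⟨⟨(h.ne_zero_right hq).symm, (h.ne_zero_right hq').symm⟩, ?_⟩
      rintro ⟨z, -, hz⟩
      have : perp q ⬝ᵥ r z = 0 := by rw [hz, dotProduct_zero]
      rw [dotProduct_sub, dotProduct_smul, dotProduct_smul, perp_dotProduct_self, smul_zero,
        sub_zero] at this
      exact smul_ne_zero h₁ hqq this
    · by_cases h₃ : q ⬝ᵥ p = 0
      · exact ⟨q, by simp, h₃⟩
      by_cases h₄ : q' ⬝ᵥ p = 0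
      · exact ⟨q', by simp, h₄⟩
      have hmem : ∀ {a b : Fin 2 → ℂ}, a ∈ A → b ∈ C → b ⬝ᵥ a ≠ 0 →
          (b ⬝ᵥ a)⁻¹ • vecMulVec a b ∈ S := fun {a b} ha hb hba => by
        rw [← vecMulVec_smul]
        exact h.idem_mem hdef ha (h.smul_right b hb _ (inv_ne_zero hba))
          (by rw [smul_dotProduct, smul_eq_mul, inv_mul_cancel₀ hba])
      have he := S.mul_mem (hmem hp hq h₃) (hmem hp' hq' h₂)
      have hf := hmem hp hq' h₄
      have hf0 : (q' ⬝ᵥ p)⁻¹ • vecMulVec p q' ≠ 0 := smul_ne_zero (inv_ne_zero h₄)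
        (vecMulVec_ne_zero_iff.2 ⟨h.ne_zero_left hp, h.ne_zero_right hq'⟩)
      let z : ℂˣ := Units.mk0 ((q ⬝ᵥ p') * (q' ⬝ᵥ p) / ((q ⬝ᵥ p) * (q' ⬝ᵥ p')))
        (div_ne_zero (mul_ne_zero h₁ h₄) (mul_ne_zero h₃ h₂))
      have hz : z ∈ Z := by
        rw [← hZ _ hf hf0]
        change z • _ ∈ S
        convert he using 1
        rw [Units.smul_def, smul_mul_smul_comm, vecMulVec_mul_vecMulVec, vecMulVec_smul, smul_smul,
          smul_smul]
        congr 1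
        simp only [z, Units.val_mk0]
        field_simp
      refine ⟨r z, Or.inr ⟨z, hz, rfl⟩, ?_⟩
      simp only [r, z, Units.val_mk0, sub_dotProduct, smul_dotProduct, smul_eq_mul]
      field_simp
      ring
  · push Not at hex
    refine ⟨{q, q'}, Set.toFinite _, ?_, fun p hp => ?_⟩
    · simp only [Set.mem_insert_iff, Set.mem_singleton_iff, not_or]
      exact ⟨(h.ne_zero_right hq).symm, (h.ne_zero_right hq').symm⟩
    · by_cases h₃ : q ⬝ᵥ p = 0
      · exact ⟨q, by simp, h₃⟩
      · exact ⟨q', by simp, hex p hp h₃⟩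

theorem lineFinite_of_finite_mult' (h : IsRect S A C) (hdef : IsInftyDefinable (S : Set M2))
    {Z : Set ℂˣ} (hZ : ∀ x ∈ S, x ≠ 0 → mult S x = Z) (hfin : Z.Finite) {p p' : Fin 2 → ℂ}
    (hp : p ∈ A) (hp' : p' ∈ A) (hpp : perp p ⬝ᵥ p' ≠ 0) : LineFinite C := by
  refine h.transposed.lineFinite_of_finite_mult hdef.preimage_transpose (fun x hx h0 => ?_) hfin
    hp hp' hpp
  rw [← hZ xᵀ hx (by simpa using h0)]
  ext z
  simp [mult]

theorem exists_finite_of_lineFinite {A C : Set (Fin 2 → ℂ)} (hA : LineFinite A)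
    (hC : LineFinite C) : ∃ M : Set M2, M.Finite ∧
      ∀ p ∈ A, ∀ q ∈ C, ∃ m ∈ M, ∃ c : ℂ, vecMulVec p q = c • m := by
  obtain ⟨R, hR, hR0, hRA⟩ := hA
  obtain ⟨R', hR', hR0', hRC⟩ := hC
  refine ⟨Set.image2 (fun w w' => vecMulVec (perp w) (perp w')) R R', hR.image2 _ hR', ?_⟩
  intro p hp q hq
  obtain ⟨w, hw, hwp⟩ := hRA p hp
  obtain ⟨w', hw', hwq⟩ := hRC q hq
  obtain ⟨a, rfl⟩ := exists_eq_smul_perp (fun h0 => hR0 (h0 ▸ hw)) hwp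
  obtain ⟨b, rfl⟩ := exists_eq_smul_perp (fun h0 => hR0' (h0 ▸ hw')) hwq
  exact ⟨_, ⟨w, hw, w', hw', rfl⟩, a * b, by
    rw [smul_vecMulVec, vecMulVec_smul, smul_smul]⟩

theorem finite_B {F G : Set CP1} (hF : LineFinite (cone F)) (hG : LineFinite (dualCone G)) :
    (B F G).Finite := by
  obtain ⟨M, hM, h⟩ := exists_finite_of_lineFinite hF hG
  refine ((hM.image proj).insert (proj 0)).subset fun y hy => ?_
  obtain ⟨x, rfl⟩ := Quotient.exists_rep y
  rcases proj_mem_B_iff.1 hy with rfl | ⟨p, hp, q, hq, rfl⟩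
  · exact Or.inl rfl
  · obtain ⟨m, hm, c, hc⟩ := h p hp q hq
    by_cases hc0 : c = 0
    · left
      exact proj_eq_proj_zero_iff.2 (by simp [hc, hc0])
    · exact Or.inr ⟨m, hm, (proj_eq_proj_iff.2 ⟨Units.mk0 c hc0, hc.symm⟩).symm⟩

theorem finite_of_finite_mult (h : IsRect S A C) {Z : Set ℂˣ}
    (hZ : ∀ x ∈ S, x ≠ 0 → mult S x = Z) (hfin : Z.Finite) (hA : LineFinite A)
    (hC : LineFinite C) : (S : Set M2).Finite := by
  obtain ⟨M, hM, hM'⟩ := exists_finite_of_lineFinite hA hC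
  have key : ∀ m : M2, {x | x ∈ S ∧ x ≠ 0 ∧ ∃ c : ℂ, x = c • m}.Finite := by
    intro m
    rcases Set.eq_empty_or_nonempty {x | x ∈ S ∧ x ≠ 0 ∧ ∃ c : ℂ, x = c • m} with he |
      ⟨y, hy, hy0, a, rfl⟩
    · rw [he]; exact Set.finite_empty
    · refine (hfin.image fun z : ℂˣ => z • a • m).subset ?_
      rintro _ ⟨hx, hx0, c, rfl⟩
      have ha : a ≠ 0 := fun h0 => hy0 (by simp [h0])
      have hc : c ≠ 0 := fun h0 => hx0 (by simp [h0])
      have hca : Units.mk0 (c / a) (div_ne_zero hc ha) • a • m = c • m := by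
        rw [Units.smul_mk0, smul_smul, div_mul_cancel₀ _ ha]
      refine ⟨Units.mk0 (c / a) (div_ne_zero hc ha), ?_, hca⟩
      rw [← hZ _ hy hy0]
      change _ • _ ∈ S
      rwa [hca]
  refine ((hM.biUnion fun m _ => key m).insert 0).subset fun x hx => ?_
  by_cases h0 : x = 0
  · exact Or.inl h0
  · right
    obtain ⟨p, hp, q, hq, rfl⟩ := h.exists_vecMulVec x hx h0
    obtain ⟨m, hm, c, hc⟩ := hM' p hp q hq
    exact Set.mem_biUnion hm ⟨hx, h0, c, hc⟩

end IsRect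

/-! ### Building blocks for definable envelopes. -/

theorem exists_eq_vecMulVec_of_vecMul_eq_zero {w : Fin 2 → ℂ} (hw : w ≠ 0) {x : M2}
    (hx : w ᵥ* x = 0) : ∃ q, x = vecMulVec (perp w) q := by
  obtain ⟨p, q, rfl⟩ := exists_eq_vecMulVec (exists_vecMul_eq_zero_iff.1 ⟨w, hw, hx⟩)
  rw [vecMul_vecMulVec, smul_eq_zero] at hx
  rcases hx with hx | rfl
  · obtain ⟨c, rfl⟩ := exists_eq_smul_perp hw hx
    exact ⟨c • q, by rw [smul_vecMulVec, vecMulVec_smul]⟩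
  · exact ⟨0, by simp⟩

/-- The vectors outside of fewer than continuum many lines. -/
def LineCosmall (A : Set (Fin 2 → ℂ)) : Prop :=
  ∃ R : Set (Fin 2 → ℂ), #R < 𝔠 ∧ 0 ∉ R ∧ ∀ p, p ≠ 0 → (p ∈ A ↔ ∀ w ∈ R, w ⬝ᵥ p ≠ 0)

theorem exists_forall_dotProduct_ne_zero {R : Set (Fin 2 → ℂ)} (hR : #R < 𝔠) (h0 : 0 ∉ R) :
    ∃ p, p ≠ 0 ∧ ∀ w ∈ R, w ⬝ᵥ p ≠ 0 := by
  obtain ⟨t, ht⟩ : ∃ t : ℂ, t ∉ (fun w : Fin 2 → ℂ => -w 0 / w 1) '' R := by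
    by_contra! h
    have : #↥((fun w : Fin 2 → ℂ => -w 0 / w 1) '' R) < 𝔠 := mk_image_le.trans_lt hR
    rw [Set.eq_univ_of_forall h, mk_univ, mk_complex] at this
    exact this.ne rfl
  -- On the affine line of vectors (1, t), each w rules out at most one t.
  refine ⟨![1, t], fun h => by simpa using congrFun h 0, fun w hw hwp => ?_⟩
  simp only [dotProduct, Fin.sum_univ_two, cons_val_zero, cons_val_one, mul_one] at hwp
  by_cases h1 : w 1 = 0
  · have h2 : w 0 = 0 := by simpa [h1] using hwp
    exact h0 (by convert hw using 1; ext i; fin_cases i <;> simp [h1, h2])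
  · exact ht ⟨w, hw, by field_simp; linear_combination -hwp⟩

/-- The matrices that are zero or have a column space spanned by an element of `A`. -/
def columnSemigroup (A : Set (Fin 2 → ℂ)) : Subsemigroup M2 where
  carrier := {x | x = 0 ∨ ∃ p ∈ A, ∃ q, x = vecMulVec p q}
  mul_mem' := by
    rintro x y (rfl | ⟨p, hp, q, rfl⟩) hy
    · exact Or.inl (zero_mul y)
    · exact Or.inr ⟨p, hp, _, vecMulVec_mul _ _ _⟩

theorem mem_columnSemigroup {A : Set (Fin 2 → ℂ)} {x : M2} :
    x ∈ columnSemigroup A ↔ x = 0 ∨ ∃ p ∈ A, ∃ q, x = vecMulVec p q := Iff.rfl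

theorem det_eq_zero_of_mem_columnSemigroup {A : Set (Fin 2 → ℂ)} {x : M2}
    (hx : x ∈ columnSemigroup A) : x.det = 0 := by
  rcases hx with rfl | ⟨p, -, q, rfl⟩
  · simp
  · exact det_vecMulVec _ _

/-- A multiplicatively closed set containing no zero, of matrices with kernel orthogonal to an
element of `R` and image not orthogonal to `perp w` for any `w ∈ R`. -/
def zeroFreeSemigroup (R : Set (Fin 2 → ℂ)) (h0 : 0 ∉ R) : Subsemigroup M2 where
  carrier := {x | (∃ w ∈ R, x *ᵥ w = 0) ∧ ∀ w ∈ R, perp w ᵥ* x ≠ 0}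
  mul_mem' := by
    rintro x y ⟨⟨w, hw, hxw⟩, hx⟩ ⟨⟨w', hw', hyw⟩, hy⟩
    refine ⟨⟨w', hw', by rw [← mulVec_mulVec, hyw, mulVec_zero]⟩, fun v hv h => ?_⟩
    have hw0 : w ≠ 0 := fun h => h0 (h ▸ hw)
    -- Since x kills w, its row is proportional to `perp w`. Applying `perp v` to x y thus gives a
    -- nonzero multiple of `perp w ᵥ* y`, which is nonzero by the condition on y.
    obtain ⟨p, hp⟩ := exists_eq_vecMulVec_of_vecMul_eq_zero (x := xᵀ) hw0
      (by rwa [vecMul_transpose])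
    have hx' : x = vecMulVec p (perp w) := by
      rw [← transpose_transpose x, hp, transpose_vecMulVec]
    have h1 := hx v hv
    rw [hx', vecMul_vecMulVec] at h1
    rw [hx', ← vecMul_vecMul, vecMul_vecMulVec, smul_vecMul] at h
    exact smul_ne_zero (left_ne_zero_of_smul h1) (hy w hw) h

theorem isDefinable_zeroFreeSemigroup {R : Set (Fin 2 → ℂ)} (hR : R.Finite) (h0 : 0 ∉ R) :
    IsDefinable (zeroFreeSemigroup R h0 : Set M2) := by
  convert (IsDefinable.biUnion hR fun w _ => isDefinable_mulVec w 0).inter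
    (IsDefinable.biInter hR fun w _ => (isDefinable_vecMul (perp w) 0).compl) using 1
  ext x
  simp only [zeroFreeSemigroup, Subsemigroup.coe_set_mk, Set.mem_ofPred_eq, Set.mem_inter_iff,
    Set.mem_iUnion, Set.mem_iInter, Set.mem_compl_iff, exists_prop, ne_eq]

/-- A semigroup of matrices whose column space is the line through `p₀`: those nilpotent with
coordinate in `U`, and those with eigenvalue in `Z`. -/
def axisSemigroup (p₀ : Fin 2 → ℂ) (Z : Subgroup ℂˣ) (U : Set ℂ) (h0 : 0 ∈ U)
    (hU : ∀ z ∈ Z, ∀ c ∈ U, (z : ℂ) * c ∈ U) : Subsemigroup M2 where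
  carrier := {x | ∃ q, x = vecMulVec p₀ q ∧
    ((∃ c ∈ U, q = c • perp p₀) ∨ ∃ z ∈ Z, q ⬝ᵥ p₀ = (z : ℂˣ))}
  mul_mem' := by
    rintro _ _ ⟨q, rfl, hq⟩ ⟨q', rfl, hq'⟩
    refine ⟨(q ⬝ᵥ p₀) • q', vecMulVec_mul_vecMulVec _ _ _ _, ?_⟩
    rcases hq with ⟨c, -, rfl⟩ | ⟨z, hz, hqz⟩
    · exact Or.inl ⟨0, h0, by simp only [smul_dotProduct, perp_dotProduct_self, smul_zero, zero_smul]⟩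
    · rcases hq' with ⟨c, hc, rfl⟩ | ⟨z', hz', hqz'⟩
      · exact Or.inl ⟨z * c, hU z hz c hc, by rw [hqz, smul_smul]⟩
      · exact Or.inr ⟨z * z', Z.mul_mem hz hz', by
          rw [smul_dotProduct, hqz, hqz', Units.val_mul, smul_eq_mul]⟩

theorem isDefinable_axisSemigroup {p₀ : Fin 2 → ℂ} (hp₀ : p₀ ≠ 0) {Z : Subgroup ℂˣ} {U : Set ℂ}
    (h0 : 0 ∈ U) (hU : ∀ z ∈ Z, ∀ c ∈ U, (z : ℂ) * c ∈ U)
    (hZ : (Z : Set ℂˣ).Finite ∨ (Z : Set ℂˣ) = Set.univ) (hUfin : U.Finite ∨ Uᶜ.Finite) :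
    IsDefinable (axisSemigroup p₀ Z U h0 hU : Set M2) := by
  have hcol : ∀ x : M2, perp p₀ ᵥ* x = 0 ↔ ∃ q, x = vecMulVec p₀ q := by
    refine fun x => ⟨fun hx => ?_, ?_⟩
    · obtain ⟨q, rfl⟩ := exists_eq_vecMulVec_of_vecMul_eq_zero (by simpa using hp₀) hx
      exact ⟨-q, by simp⟩
    · rintro ⟨q, rfl⟩
      rw [vecMul_vecMulVec, perp_dotProduct_self, zero_smul]
  have hmul : ∀ q (c : ℂ), vecMulVec p₀ q *ᵥ p₀ = c • p₀ ↔ q ⬝ᵥ p₀ = c := fun q c => by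
    rw [vecMulVec_mulVec, op_smul_eq_smul]
    exact (smul_left_injective ℂ hp₀).eq_iff
  have hset : (axisSemigroup p₀ Z U h0 hU : Set M2) =
      (fun c => vecMulVec p₀ (c • perp p₀)) '' U ∪
        ({x | perp p₀ ᵥ* x = 0} ∩ ⋃ z ∈ Z, {x | x *ᵥ p₀ = (z : ℂ) • p₀}) := by
    ext x
    simp only [Set.mem_union, Set.mem_inter_iff, Set.mem_ofPred_eq, hcol, Set.mem_iUnion,
      Set.mem_image]
    constructor
    · rintro ⟨q, rfl, ⟨c, hc, rfl⟩ | ⟨z, hz, hqz⟩⟩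
      · exact Or.inl ⟨c, hc, rfl⟩
      · exact Or.inr ⟨⟨q, rfl⟩, z, hz, (hmul _ _).2 hqz⟩
    · rintro (⟨c, hc, rfl⟩ | ⟨⟨q, rfl⟩, z, hz, hqz⟩)
      · exact ⟨_, rfl, Or.inl ⟨c, hc, rfl⟩⟩
      · exact ⟨q, rfl, Or.inr ⟨z, hz, (hmul _ _).1 hqz⟩⟩
  rw [hset]
  refine IsDefinable.union ?_ ?_
  · rcases hUfin with hfin | hfin
    · exact isDefinable_of_finite (hfin.image _)
    · have : (fun c => vecMulVec p₀ (c • perp p₀)) '' U =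
          ({x : M2 | perp p₀ ᵥ* x = 0} ∩ {x | x *ᵥ p₀ = 0}) ∩
            ((fun c => vecMulVec p₀ (c • perp p₀)) '' Uᶜ)ᶜ := by
        have hinj : Function.Injective fun c : ℂ => vecMulVec p₀ (c • perp p₀) := fun a b hab => by
          simp only [vecMulVec_smul] at hab
          exact smul_left_injective ℂ (vecMulVec_ne_zero_iff.2 ⟨hp₀, by simpa using hp₀⟩) hab
        rw [Set.image_compl_eq_range_sdiff_image hinj]
        ext x
        simp only [Set.mem_inter_iff, Set.mem_compl_iff, Set.mem_sdiff, not_and, not_not,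
          Set.mem_ofPred_eq, hcol]
        constructor
        · rintro ⟨c, hc, rfl⟩
          refine ⟨⟨⟨_, rfl⟩, ?_⟩, fun _ => ⟨c, hc, rfl⟩⟩
          rw [← zero_smul ℂ p₀, hmul, smul_dotProduct, perp_dotProduct_self, smul_zero]
        · rintro ⟨⟨⟨q, rfl⟩, hx⟩, h⟩
          rw [← zero_smul ℂ p₀, hmul, dotProduct_comm] at hx
          obtain ⟨c, rfl⟩ := exists_eq_smul_perp hp₀ hx
          exact h ⟨c, rfl⟩
      rw [this]
      exact ((isDefinable_vecMul _ _).inter (isDefinable_mulVec _ _)).inter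
        (isDefinable_of_finite (hfin.image _)).compl
  · rcases hZ with hfin | huniv
    · exact (isDefinable_vecMul _ _).inter (.biUnion hfin fun z _ => isDefinable_mulVec _ _)
    · convert (isDefinable_vecMul (perp p₀) 0).inter (isDefinable_mulVec p₀ 0).compl using 1
      ext x
      have hZ : ∀ z, z ∈ Z := fun z => by rw [← SetLike.mem_coe, huniv]; trivial
      simp only [Set.mem_inter_iff, Set.mem_iUnion, Set.mem_compl_iff, Set.mem_ofPred_eq, hcol, hZ,
        exists_const]
      refine and_congr_right ?_
      rintro ⟨q, rfl⟩
      rw [← zero_smul ℂ p₀]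
      simp only [hmul]
      exact ⟨fun ⟨z, hz⟩ => hz ▸ z.ne_zero, fun hne => ⟨Units.mk0 _ hne, rfl⟩⟩

/-! ### The shape of the set of columns. -/

namespace IsRect

variable {S : Subsemigroup M2} {A C : Set (Fin 2 → ℂ)}

/-- Discarding the lines that miss A suffices: A is stable under nonzero scalars, so it contains all
nonzero vectors of any line it meets. -/
theorem exists_finite_forall_mem_iff (h : IsRect S A C) (hA : LineFinite A) :
    ∃ R : Set (Fin 2 → ℂ), R.Finite ∧ 0 ∉ R ∧ ∀ p, p ≠ 0 → (p ∈ A ↔ ∃ w ∈ R, w ⬝ᵥ p = 0) := by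
  obtain ⟨R, hR, hR0, hRA⟩ := hA
  refine ⟨{w ∈ R | ∃ p ∈ A, w ⬝ᵥ p = 0}, hR.subset (Set.sep_subset _ _), fun h => hR0 h.1,
    fun p hp0 => ⟨fun hp => ?_, ?_⟩⟩
  · obtain ⟨w, hw, hwp⟩ := hRA p hp
    exact ⟨w, ⟨hw, p, hp, hwp⟩, hwp⟩
  · rintro ⟨w, ⟨hw, p', hp', hwp'⟩, hwp⟩
    exact h.mem_left_of_dotProduct_eq_zero (fun h => hR0 (h ▸ hw)) hp' hp0 hwp' hwp

/-- For q ∈ C the matrices (p₀ + t `perp q`) qᵀ with q ⬝ p₀ = 1 form an affine line of idempotents,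
and such a matrix lies in S exactly when its column lies in A. Up to scalars these columns represent
every direction except that of `perp q`. -/
theorem lineFinite_or_lineCosmall (h : IsRect S A C) (hdef : IsInftyDefinable (S : Set M2))
    (hC : C.Nonempty) : LineFinite A ∨ LineCosmall A := by
  obtain ⟨q, hq⟩ := hC
  have hq0 := h.ne_zero_right hq
  obtain ⟨p₀, hp₀⟩ : ∃ p₀, q ⬝ᵥ p₀ = 1 := by
    obtain ⟨p, hp⟩ := exists_dotProduct_ne_zero hq0
    refine ⟨(p ⬝ᵥ q)⁻¹ • p, ?_⟩
    rw [dotProduct_comm, smul_dotProduct, smul_eq_mul, inv_mul_cancel₀ hp]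
  have hqt : ∀ t : ℂ, q ⬝ᵥ (p₀ + t • perp q) = 1 := fun t => by
    rw [dotProduct_add, dotProduct_smul, dotProduct_perp_self, hp₀, smul_zero, add_zero]
  have ht0 : ∀ t : ℂ, p₀ + t • perp q ≠ 0 := fun t h => by
    have := hqt t
    simp [h] at this
  have hmem : ∀ t : ℂ, vecMulVec p₀ q + t • vecMulVec (perp q) q ∈ (S : Set M2) ↔
      p₀ + t • perp q ∈ A := fun t => by
    rw [← smul_vecMulVec, ← add_vecMulVec]
    refine ⟨fun hS => (h.mem_of_vecMulVec_mem (z := 1) (by simpa) (ht0 t) hq0).1, fun hA => ?_⟩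
    exact h.idem_mem hdef hA hq (hqt t)
  have hdecomp : ∀ p, q ⬝ᵥ p ≠ 0 → ∃ t : ℂ, p = (q ⬝ᵥ p) • (p₀ + t • perp q) := fun p hp => by
    obtain ⟨c, hc⟩ := exists_eq_smul_perp (p := p - (q ⬝ᵥ p) • p₀) hq0
      (by rw [dotProduct_sub, dotProduct_smul, hp₀, smul_eq_mul, mul_one, sub_self])
    refine ⟨(q ⬝ᵥ p)⁻¹ * c, ?_⟩
    rw [smul_add, smul_smul, mul_inv_cancel_left₀ hp, ← hc, add_sub_cancel]
  have hperp : ∀ t c : ℂ, perp (p₀ + t • perp q) ⬝ᵥ c • (p₀ + t • perp q) = 0 := fun t c => by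
    rw [dotProduct_smul, perp_dotProduct_self, smul_zero]
  have hdich := hdef.finiteOrCosmall_line (vecMulVec p₀ q) (vecMulVec (perp q) q)
  simp only [hmem] at hdich
  refine hdich.imp (fun hfin => ?_) fun hsmall => ?_
  · refine ⟨insert q ((fun t : ℂ => perp (p₀ + t • perp q)) '' {t | p₀ + t • perp q ∈ A}),
      (hfin.image _).insert _, ?_, fun p hp => ?_⟩
    · rintro (h0 | ⟨t, -, ht⟩)
      · exact hq0 h0.symm
      · exact ht0 t (perp_eq_zero.1 ht)
    · by_cases hqp : q ⬝ᵥ p = 0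
      · exact ⟨q, Or.inl rfl, hqp⟩
      · obtain ⟨t, ht⟩ := hdecomp p hqp
        refine ⟨_, Or.inr ⟨t, ?_, rfl⟩, ht ▸ hperp t _⟩
        have := h.smul_left p hp _ (inv_ne_zero hqp)
        rwa [ht, smul_smul, ← ht, inv_mul_cancel₀ hqp, one_smul] at this
  -- The second set handles the one direction, that of `perp q`, not seen by the affine line.
  · refine ⟨(fun t : ℂ => perp (p₀ + t • perp q)) '' {t | p₀ + t • perp q ∈ A}ᶜ ∪
      {w | w = q ∧ perp q ∉ A}, ?_, ?_, fun p hp => ⟨fun hpA => ?_, fun hR => ?_⟩⟩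
    · refine (mk_union_le _ _).trans_lt (add_lt_of_lt aleph0_le_continuum
        (mk_image_le.trans_lt hsmall) (mk_lt_continuum_of_finite ?_))
      exact (Set.finite_singleton q).subset fun w hw => hw.1
    · rintro (⟨t, -, ht⟩ | ⟨h0, -⟩)
      · exact ht0 t (perp_eq_zero.1 ht)
      · exact hq0 h0.symm
    · rintro w (⟨t, ht, rfl⟩ | ⟨rfl, hw⟩) hwp
      · exact ht (h.mem_left_of_dotProduct_eq_zero (perp_eq_zero.not.2 (ht0 t)) hpA (ht0 t) hwp
          (perp_dotProduct_self _))
      · exact hw (h.mem_left_of_dotProduct_eq_zero hq0 hpA (perp_eq_zero.not.2 hq0) hwp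
          (dotProduct_perp_self _))
    · by_cases hqp : q ⬝ᵥ p = 0
      · have hqA : perp q ∈ A := by
          by_contra hqA
          exact hR q (Or.inr ⟨rfl, hqA⟩) hqp
        exact h.mem_left_of_dotProduct_eq_zero hq0 hqA hp (dotProduct_perp_self _) hqp
      · obtain ⟨t, ht⟩ := hdecomp p hqp
        have htA : p₀ + t • perp q ∈ A := by
          by_contra htA
          exact hR _ (Or.inl ⟨t, htA, rfl⟩) (ht ▸ hperp t _)
        rw [ht]
        exact h.smul_left _ htA _ hqp

theorem isInter_columnSemigroup (h : IsRect S A C) (hA : LineFinite A ∨ LineCosmall A) :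
    IsInterOfDefinableSemigroups (columnSemigroup A : Set M2) := by
  rcases hA with hA | ⟨R, hR, hR0, hRA⟩
  · obtain ⟨R, hR, hR0, hRA⟩ := h.exists_finite_forall_mem_iff hA
    refine .of_isDefinable ?_ fun x => det_eq_zero_of_mem_columnSemigroup
    convert (isDefinable_singleton 0).union
      (IsDefinable.biUnion hR fun w _ => isDefinable_vecMul w 0) using 1
    ext x
    simp only [SetLike.mem_coe, mem_columnSemigroup, Set.mem_union, Set.mem_singleton_iff,
      Set.mem_iUnion, Set.mem_ofPred_eq, exists_prop]
    refine or_congr_right ⟨?_, ?_⟩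
    · rintro ⟨p, hp, q, rfl⟩
      obtain ⟨w, hw, hwp⟩ := (hRA p (h.ne_zero_left hp)).1 hp
      exact ⟨w, hw, by rw [vecMul_vecMulVec, hwp, zero_smul]⟩
    · rintro ⟨w, hw, hwx⟩
      have hw0 : w ≠ 0 := fun h => hR0 (h ▸ hw)
      obtain ⟨q, rfl⟩ := exists_eq_vecMulVec_of_vecMul_eq_zero hw0 hwx
      exact ⟨_, (hRA _ (perp_eq_zero.not.2 hw0)).2 ⟨w, hw, dotProduct_perp_self w⟩, q, rfl⟩
  -- One semigroup per omitted line; `none` gives all singular matrices, so that singularity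
  -- survives even if R is empty.
  · let T : Option R → Subsemigroup M2 := fun o => columnSemigroup {p | ∀ w ∈ o, w.1 ⬝ᵥ p ≠ 0}
    have hT : ∀ o, (T o : Set M2) = {x | x.det = 0} ∩
        ({0} ∪ ⋂ w ∈ {w | w ∈ o}, {x : M2 | w.1 ᵥ* x = 0}ᶜ) := by
      intro o
      ext x
      simp only [T, SetLike.mem_coe, mem_columnSemigroup, Set.mem_inter_iff, Set.mem_union,
        Set.mem_singleton_iff, Set.mem_iInter, Set.mem_ofPred_eq, Set.mem_compl_iff]
      constructor
      · rintro (rfl | ⟨p, hp, q, rfl⟩)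
        · simp
        · refine ⟨det_vecMulVec _ _, ?_⟩
          by_cases hq : q = 0
          · simp [hq]
          · refine Or.inr fun w hw => ?_
            rw [vecMul_vecMulVec]
            exact smul_ne_zero (hp w hw) hq
      · rintro ⟨hdet, rfl | hx⟩
        · exact Or.inl rfl
        · obtain ⟨p, q, rfl⟩ := exists_eq_vecMulVec hdet
          refine Or.inr ⟨p, fun w hw hwp => hx w hw ?_, q, rfl⟩
          rw [vecMul_vecMulVec, hwp, zero_smul]
    have hX : (columnSemigroup A : Set M2) = ⋂ o, (T o : Set M2) := by
      ext x
      simp only [Set.mem_iInter, hT]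
      constructor
      · rintro (rfl | ⟨p, hp, q, rfl⟩) o
        · simp
        · rw [← hT]
          exact Or.inr ⟨p, fun w hw => (hRA p (h.ne_zero_left hp)).1 hp w w.2, q, rfl⟩
      · intro hx
        by_cases hx0 : x = 0
        · exact Or.inl hx0
        obtain ⟨p, q, rfl⟩ := exists_eq_vecMulVec (hx none).1
        have hp0 := (vecMulVec_ne_zero_iff.1 hx0).1
        refine Or.inr ⟨p, (hRA p hp0).2 fun w hw hwp => ?_, q, rfl⟩
        have := (hx (some ⟨w, hw⟩)).2.resolve_left hx0
        simp only [Set.mem_iInter] at this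
        exact this ⟨w, hw⟩ rfl (by
          simp only [Set.mem_ofPred_eq]; rw [vecMul_vecMulVec, hwp, zero_smul])
    rw [hX]
    refine .iInter ?_ fun o => ⟨T o, ?_, fun x => det_eq_zero_of_mem_columnSemigroup, rfl⟩
    · rw [mk_option]
      exact add_lt_of_lt aleph0_le_continuum hR (one_lt_aleph0.trans aleph0_lt_continuum)
    · rw [hT]
      refine isDefinable_det.inter ((isDefinable_singleton 0).union (.biInter ?_ fun w _ =>
        (isDefinable_vecMul _ _).compl))
      exact Set.Subsingleton.finite fun a ha b hb => Option.some.inj (ha.symm.trans hb)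

end IsRect

/-! ### S as an intersection of definable semigroups. -/

namespace IsRect

variable {S : Subsemigroup M2} {A C : Set (Fin 2 → ℂ)}

theorem subset_zero (h : IsRect S A C) (hAC : ¬(A.Nonempty ∧ C.Nonempty)) :
    (S : Set M2) ⊆ {0} := by
  intro x hx
  by_contra h0
  obtain ⟨p, hp, q, hq, -⟩ := h.exists_vecMulVec x hx h0
  exact hAC ⟨⟨p, hp⟩, q, hq⟩

theorem det_eq_zero (h : IsRect S A C) {x : M2} (hx : x ∈ S) : x.det = 0 := by
  by_cases h0 : x = 0
  · simp [h0]
  · obtain ⟨p, -, q, -, rfl⟩ := h.exists_vecMulVec x hx h0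
    exact det_vecMulVec _ _

theorem regular_of_forall (hA : A.Nonempty) (hC : C.Nonempty)
    (hne : ∀ p ∈ A, ∀ q ∈ C, q ⬝ᵥ p ≠ 0) : Regular A C :=
  ⟨fun p hp => ⟨_, hC.some_mem, hne p hp _ hC.some_mem⟩,
    fun q hq => ⟨_, hA.some_mem, hne _ hA.some_mem q hq⟩⟩

/-- In the plane, a nonzero vector cannot be orthogonal to two independent vectors. -/
theorem regular_of_exists (h : IsRect S A C) {p p' q q' : Fin 2 → ℂ} (hp : p ∈ A) (hp' : p' ∈ A)
    (hpp : perp p ⬝ᵥ p' ≠ 0) (hq : q ∈ C) (hq' : q' ∈ C) (hqq : perp q ⬝ᵥ q' ≠ 0) :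
    Regular A C := by
  have key : ∀ {r s t : Fin 2 → ℂ}, r ≠ 0 → perp s ⬝ᵥ t ≠ 0 → s ⬝ᵥ r = 0 → t ⬝ᵥ r ≠ 0 := by
    intro r s t hr hst hs ht
    rw [dotProduct_comm] at hs ht
    obtain ⟨a, rfl⟩ := exists_eq_smul_perp hr hs
    obtain ⟨b, rfl⟩ := exists_eq_smul_perp hr ht
    apply hst
    rw [perp_smul, smul_dotProduct, dotProduct_smul, perp_dotProduct_self, smul_zero, smul_zero]
  refine ⟨fun r hr => ?_, fun r hr => ?_⟩
  · by_cases hqr : q ⬝ᵥ r = 0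
    · exact ⟨q', hq', key (h.ne_zero_left hr) hqq hqr⟩
    · exact ⟨q, hq, hqr⟩
  · by_cases hpr : p ⬝ᵥ r = 0
    · exact ⟨p', hp', dotProduct_comm p' r ▸ key (h.ne_zero_right hr) hpp hpr⟩
    · exact ⟨p, hp, dotProduct_comm p r ▸ hpr⟩

theorem dotProduct_ne_zero_of_nil (h : IsRect S A C) (hnil : ∀ n ∈ S, n ∈ Nil → n = 0)
    {p q : Fin 2 → ℂ} (hp : p ∈ A) (hq : q ∈ C) : q ⬝ᵥ p ≠ 0 := by
  intro h0
  obtain ⟨z, hz⟩ := h.exists_smul_mem p hp q hq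
  refine smul_ne_zero_iff_ne z |>.2
    (vecMulVec_ne_zero_iff.2 ⟨h.ne_zero_left hp, h.ne_zero_right hq⟩) (hnil _ hz ?_)
  change _ * _ = 0
  rw [smul_mul_smul_comm, vecMulVec_mul_vecMulVec, h0, zero_smul, vecMulVec_zero, smul_zero]

theorem dotProduct_ne_zero_of_zero_notMem (h : IsRect S A C) (h0 : (0 : M2) ∉ S)
    {p q : Fin 2 → ℂ} (hp : p ∈ A) (hq : q ∈ C) : q ⬝ᵥ p ≠ 0 :=
  h.dotProduct_ne_zero_of_nil
    (fun n hn hnn => absurd (by have := S.mul_mem hn hn; rwa [show n * n = 0 from hnn] at this) h0)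
    hp hq

/-- With finitely many kernels, the condition that no image equals a kernel is definable,
multiplicative and false at 0. It holds on S because a zero pairing would produce a nilpotent, whose
square is 0. -/
theorem exists_zero_notMem_of_lineFinite (h : IsRect S A C) (h0 : (0 : M2) ∉ S)
    (hC : LineFinite C) : ∃ X : Set M2, IsInterOfDefinableSemigroups X ∧ (S : Set M2) ⊆ X ∧
      0 ∉ X := by
  obtain ⟨R, hR, hR0, hRC⟩ := h.transposed.exists_finite_forall_mem_iff hC
  refine ⟨zeroFreeSemigroup R hR0, .of_isDefinable (isDefinable_zeroFreeSemigroup hR hR0) ?_,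
    fun x hx => ?_, ?_⟩
  · rintro x ⟨⟨w, hw, hwx⟩, -⟩
    exact exists_mulVec_eq_zero_iff.1 ⟨w, fun h => hR0 (h ▸ hw), hwx⟩
  · obtain ⟨p, hp, q, hq, rfl⟩ := h.exists_vecMulVec x hx fun h => h0 (h ▸ hx)
    constructor
    · obtain ⟨w, hw, hwq⟩ := (hRC q (h.ne_zero_right hq)).1 hq
      refine ⟨w, hw, ?_⟩
      rw [vecMulVec_mulVec, dotProduct_comm, hwq, MulOpposite.op_zero, zero_smul]
    · intro w hw
      have hw0 : perp w ≠ 0 := perp_eq_zero.not.2 fun h => hR0 (h ▸ hw)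
      rw [vecMul_vecMulVec]
      exact smul_ne_zero (h.dotProduct_ne_zero_of_zero_notMem h0 hp
        ((hRC _ hw0).2 ⟨w, hw, dotProduct_perp_self w⟩)) (h.ne_zero_right hq)
  · rintro ⟨⟨w, hw, -⟩, hx⟩
    exact hx w hw (vecMul_zero _)

theorem exists_zero_notMem (h : IsRect S A C) (hdef : IsInftyDefinable (S : Set M2))
    (h0 : (0 : M2) ∉ S) (hA : A.Nonempty) (hC : C.Nonempty) :
    ∃ X : Set M2, IsInterOfDefinableSemigroups X ∧ (S : Set M2) ⊆ X ∧ 0 ∉ X := by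
  rcases h.transposed.lineFinite_or_lineCosmall hdef.preimage_transpose hA with hfin |
    ⟨R, hR, hR0, hRC⟩
  · exact h.exists_zero_notMem_of_lineFinite h0 hfin
  rcases h.lineFinite_or_lineCosmall hdef hC with hfin | ⟨R', hR', hR0', hRA⟩
  · obtain ⟨X, hX, hSX, hX0⟩ := h.transposed.exists_zero_notMem_of_lineFinite (by simpa) hfin
    exact ⟨_, hX.preimage_transpose, fun x hx => hSX (by simpa using hx), by simpa⟩
  -- If both sides omit few lines, some p lies in A with `perp p` in C, and S contains a nilpotent.
  · exfalso
    obtain ⟨p, hp0, hp⟩ := exists_forall_dotProduct_ne_zero (R := R' ∪ perp '' R)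
      ((mk_union_le _ _).trans_lt (add_lt_of_lt aleph0_le_continuum hR' (mk_image_le.trans_lt hR)))
      (by
        rintro (h | ⟨w, hw, hw0⟩)
        · exact hR0' h
        · exact hR0 (perp_eq_zero.1 hw0 ▸ hw))
    have hpA : p ∈ A := (hRA p hp0).2 fun w hw => hp w (Or.inl hw)
    have hpC : perp p ∈ C := (hRC _ (perp_eq_zero.not.2 hp0)).2 fun w hw hwp =>
      hp _ (Or.inr ⟨w, hw, rfl⟩) (by
        rw [perp_dotProduct_comm, dotProduct_comm, hwp, neg_zero])
    exact h.dotProduct_ne_zero_of_zero_notMem h0 hpA hpC (perp_dotProduct_self p)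

theorem isInter_of_union_zero (h : IsRect S A C) (hdef : IsInftyDefinable (S : Set M2))
    (hA : A.Nonempty) (hC : C.Nonempty)
    (hS : IsInterOfDefinableSemigroups ((S : Set M2) ∪ {0})) :
    IsInterOfDefinableSemigroups (S : Set M2) := by
  by_cases h0 : (0 : M2) ∈ S
  · rwa [Set.union_eq_self_of_subset_right (by simpa using h0)] at hS
  · obtain ⟨X, hX, hSX, hX0⟩ := h.exists_zero_notMem hdef h0 hA hC
    convert hS.inter hX using 1
    refine Set.Subset.antisymm (fun x hx => ⟨Or.inl hx, hSX hx⟩) ?_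
    rintro x ⟨hx | rfl, hx'⟩
    exacts [hx, absurd hx' hX0]

theorem isInter_rows (h : IsRect S A C) (hdef : IsInftyDefinable (S : Set M2))
    (hA : A.Nonempty) :
    IsInterOfDefinableSemigroups (transpose ⁻¹' (columnSemigroup C : Set M2)) :=
  (h.transposed.isInter_columnSemigroup
    (h.transposed.lineFinite_or_lineCosmall hdef.preimage_transpose hA)).preimage_transpose

theorem vecMulVec_mem_rows_iff (h : IsRect S A C) {p q : Fin 2 → ℂ} (hp : p ≠ 0) (hq : q ≠ 0) :
    vecMulVec p q ∈ transpose ⁻¹' (columnSemigroup C : Set M2) ↔ q ∈ C := by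
  simp only [Set.mem_preimage, transpose_vecMulVec, SetLike.mem_coe, mem_columnSemigroup]
  constructor
  · rintro (h0 | ⟨q', hq', p', he⟩)
    · exact absurd h0 (vecMulVec_ne_zero_iff.2 ⟨hq, hp⟩)
    · obtain ⟨c, hc, rfl, -⟩ := eq_smul_of_vecMulVec_eq he hq hp
      have := h.smul_right _ hq' _ (inv_ne_zero hc)
      rwa [smul_smul, inv_mul_cancel₀ hc, one_smul] at this
  · exact fun hq => Or.inr ⟨q, hq, p, rfl⟩

/-- A saturated stable subset of the line of nilpotents is an intersection of a small family of
stable sets that are finite or cofinite. -/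
theorem exists_family {Z : Subgroup ℂˣ} (hZ : (Z : Set ℂˣ).Finite ∨ (Z : Set ℂˣ) = Set.univ)
    {N : Set ℂ} (hN : FiniteOrCosmall N) (h0 : 0 ∈ N) (hst : ∀ z ∈ Z, ∀ c ∈ N, (z : ℂ) * c ∈ N) :
    ∃ (ι : Type) (_ : Nonempty ι) (U : ι → Set ℂ), #ι < 𝔠 ∧ N = ⋂ i, U i ∧
      ∀ i, 0 ∈ U i ∧ (∀ z ∈ Z, ∀ c ∈ U i, (z : ℂ) * c ∈ U i) ∧ ((U i).Finite ∨ (U i)ᶜ.Finite) := by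
  rcases hN with hfin | hsmall
  · exact ⟨Unit, inferInstance, fun _ => N, mk_lt_aleph0.trans aleph0_lt_continuum,
      (Set.iInter_const N).symm, fun _ => ⟨h0, hst, Or.inl hfin⟩⟩
  -- Each member removes the Z-orbit of one point outside N: finitely many points if Z is finite,
  -- all nonzero ones if Z is ℂˣ. The index `none` keeps the family nonempty.
  · refine ⟨Option ↥Nᶜ, inferInstance, fun o => {c | ∀ m ∈ o, ∀ z ∈ Z, c ≠ (z : ℂ) * m.1}, ?_, ?_,
      fun o => ⟨?_, ?_, ?_⟩⟩
    · rw [mk_option]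
      exact add_lt_of_lt aleph0_le_continuum hsmall (one_lt_aleph0.trans aleph0_lt_continuum)
    · ext c
      simp only [Set.mem_iInter, Set.mem_ofPred_eq]
      constructor
      · rintro hc o m - z hz rfl
        have := hst _ (Z.inv_mem hz) _ hc
        rw [← mul_assoc, ← Units.val_mul, inv_mul_cancel, Units.val_one, one_mul] at this
        exact m.2 this
      · intro hc
        by_contra hcN
        exact hc (some ⟨c, hcN⟩) ⟨c, hcN⟩ rfl 1 Z.one_mem (by simp)
    · intro m _ z _ hm
      have : m.1 = 0 := by simpa using hm.symm
      exact m.2 (this ▸ h0)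
    · intro z hz c hc m hm z' hz' he
      refine hc m hm (z⁻¹ * z') (Z.mul_mem (Z.inv_mem hz) hz') ?_
      rw [Units.val_mul, mul_assoc, ← he, ← mul_assoc, ← Units.val_mul, inv_mul_cancel,
        Units.val_one, one_mul]
    · rcases o with - | m
      · right; simp
      · rcases hZ with hfin | huniv
        · right
          refine (hfin.image fun z : ℂˣ => (z : ℂ) * m.1).subset fun c hc => ?_
          simp only [Set.mem_compl_iff, Set.mem_ofPred_eq, not_forall, not_not] at hc
          obtain ⟨m', hm', z, hz, rfl⟩ := hc
          cases hm'
          exact ⟨z, hz, rfl⟩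
        · left
          refine (Set.finite_singleton 0).subset fun c hc => ?_
          by_contra hc0
          have hm0 : m.1 ≠ 0 := fun h => m.2 (h ▸ h0)
          have hz : ∀ z, z ∈ Z := fun z => by rw [← SetLike.mem_coe, huniv]; trivial
          exact hc m rfl (Units.mk0 (c / m.1) (div_ne_zero hc0 hm0)) (hz _)
            (by rw [Units.val_mk0, div_mul_cancel₀ _ hm0])

/-- When all images coincide, an idempotent e = p₀ qᵀ is a left identity, so Z = Z_e acts on S; also
x e = (q' ⬝ p₀) e for x = p₀ q'ᵀ, so nonzero eigenvalues lie in Z. Without such an e all of S is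
nilpotent and Z is trivial. -/
theorem exists_subgroup_of_axis (h : IsRect S A C) (hdef : IsInftyDefinable (S : Set M2))
    {p₀ : Fin 2 → ℂ} (hp₀ : p₀ ∈ A) (hA : ∀ p ∈ A, perp p₀ ⬝ᵥ p = 0) :
    ∃ Z : Subgroup ℂˣ, ((Z : Set ℂˣ).Finite ∨ (Z : Set ℂˣ) = Set.univ) ∧
      (∀ z ∈ Z, ∀ s ∈ S, z • s ∈ S) ∧
      ∀ q, vecMulVec p₀ q ∈ S → q ⬝ᵥ p₀ = 0 ∨ ∃ z ∈ Z, q ⬝ᵥ p₀ = (z : ℂˣ) := by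
  have hp0 := h.ne_zero_left hp₀
  by_cases hex : ∃ q ∈ C, q ⬝ᵥ p₀ ≠ 0
  · obtain ⟨q, hq, hqp⟩ := h.exists_dotProduct_eq_one hex
    have he := h.idem_mem hdef hp₀ hq hqp
    obtain ⟨Z, hZ, hfin⟩ := exists_subgroup_mult hdef (z := 1) (vecMulVec_mul_self hqp) (by simpa)
    refine ⟨Z, hZ ▸ hfin, fun z hz s hs => ?_, fun q' hq' => or_iff_not_imp_left.2 fun hne => ?_⟩
    · have hz' : z • vecMulVec p₀ q ∈ S := by
        rw [← SetLike.mem_coe, hZ] at hz; exact hz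
      by_cases hs0 : s = 0
      · rw [hs0, smul_zero]; rwa [hs0] at hs
      obtain ⟨p, hp, q', -, rfl⟩ := h.exists_vecMulVec s hs hs0
      obtain ⟨c, -, rfl⟩ := exists_eq_smul_of_dotProduct_eq_zero (perp_eq_zero.not.2 hp0) hp0
        (h.ne_zero_left hp) (perp_dotProduct_self _) (hA p hp)
      have := S.mul_mem hz' hs
      rwa [smul_mul_assoc, smul_vecMulVec, mul_smul_comm, vecMulVec_mul_vecMulVec, hqp, one_smul,
        ← smul_vecMulVec] at this
    · refine ⟨Units.mk0 _ hne, ?_, rfl⟩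
      rw [← SetLike.mem_coe, hZ]
      change _ • _ ∈ S
      have := S.mul_mem hq' he
      rwa [vecMulVec_mul_vecMulVec, vecMulVec_smul] at this
  · push Not at hex
    refine ⟨⊥, Or.inl (by simp), fun z hz s hs => ?_, fun q hq => Or.inl ?_⟩
    · rw [Subgroup.mem_bot.1 hz, one_smul]; exact hs
    · by_cases hq0 : q = 0
      · simp [hq0]
      · exact hex q (h.mem_of_vecMulVec_mem (z := 1) (by simpa) hp0 hq0).2

theorem isInter_union_zero_of_axis (h : IsRect S A C) (hdef : IsInftyDefinable (S : Set M2))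
    {p₀ : Fin 2 → ℂ} (hp₀ : p₀ ∈ A) (hA : ∀ p ∈ A, perp p₀ ⬝ᵥ p = 0) :
    IsInterOfDefinableSemigroups ((S : Set M2) ∪ {0}) := by
  have hp0 := h.ne_zero_left hp₀
  obtain ⟨Z, hZ, hZS, hSZ⟩ := h.exists_subgroup_of_axis hdef hp₀ hA
  -- The nilpotents with image p₀ form one line, with coordinate c; zero is adjoined to N so that
  -- `axisSemigroup` applies.
  let N : Set ℂ := {c | c • vecMulVec p₀ (perp p₀) ∈ S} ∪ {0}
  have hN : FiniteOrCosmall N := by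
    have := hdef.finiteOrCosmall_line 0 (vecMulVec p₀ (perp p₀))
    simp only [zero_add] at this
    refine this.imp (fun h => h.union (Set.finite_singleton _)) fun h => ?_
    exact (mk_le_mk_of_subset (Set.compl_subset_compl.2 Set.subset_union_left)).trans_lt h
  have hst : ∀ z ∈ Z, ∀ c ∈ N, (z : ℂ) * c ∈ N := by
    rintro z hz c (hc | rfl)
    · left
      have := hZS z hz _ hc
      rwa [Units.smul_def, smul_smul] at this
    · right; simp
  obtain ⟨ι, _, U, hι, hNU, hU⟩ := exists_family hZ hN (Or.inr rfl) hst
  let T : ι → Subsemigroup M2 := fun i => axisSemigroup p₀ Z (U i) (hU i).1 (hU i).2.1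
  have hT : IsInterOfDefinableSemigroups (⋂ i, (T i : Set M2)) := by
    refine .iInter hι fun i => ⟨T i, isDefinable_axisSemigroup hp0 _ _ hZ (hU i).2.2, ?_, rfl⟩
    rintro x ⟨q, rfl, -⟩
    exact det_vecMulVec _ _
  convert (h.isInter_rows hdef ⟨p₀, hp₀⟩).inter hT using 1
  refine Set.Subset.antisymm (fun x hx => ?_) ?_
  · by_cases hx0 : x = 0
    · subst hx0
      refine ⟨Or.inl transpose_zero, Set.mem_iInter.2 fun i => ⟨0, by simp, Or.inl ⟨0, (hU i).1, ?_⟩⟩⟩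
      simp
    have hxS : x ∈ S := hx.resolve_right hx0
    obtain ⟨p, hp, q, hq, rfl⟩ := h.exists_vecMulVec x hxS hx0
    refine ⟨(h.vecMulVec_mem_rows_iff (h.ne_zero_left hp) (h.ne_zero_right hq)).2 hq,
      Set.mem_iInter.2 fun i => ?_⟩
    obtain ⟨c, -, rfl⟩ := exists_eq_smul_of_dotProduct_eq_zero (perp_eq_zero.not.2 hp0) hp0
      (h.ne_zero_left hp) (perp_dotProduct_self _) (hA p hp)
    rw [smul_vecMulVec, ← vecMulVec_smul] at hxS ⊢
    refine ⟨_, rfl, ?_⟩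
    rcases hSZ _ hxS with h1 | h1
    · left
      rw [dotProduct_comm] at h1
      obtain ⟨a, ha⟩ := exists_eq_smul_perp hp0 h1
      refine ⟨a, ?_, ha⟩
      have : a ∈ N := Or.inl (by
        rw [ha, vecMulVec_smul] at hxS
        exact hxS)
      rw [hNU] at this
      exact Set.mem_iInter.1 this i
    · exact Or.inr h1
  · rintro x ⟨hrow, hx⟩
    rw [Set.mem_iInter] at hx
    by_cases hx0 : x = 0
    · exact Or.inr hx0
    left
    obtain ⟨q, rfl, -⟩ := hx (Classical.arbitrary ι)
    have hq0 := (vecMulVec_ne_zero_iff.1 hx0).2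
    have hqC := (h.vecMulVec_mem_rows_iff hp0 hq0).1 hrow
    have hx' : ∀ i, (∃ c ∈ U i, q = c • perp p₀) ∨ ∃ z ∈ Z, q ⬝ᵥ p₀ = (z : ℂˣ) := fun i => by
      obtain ⟨q', he, hq'⟩ := hx i
      rw [← sub_eq_zero, ← vecMulVec_sub, vecMulVec_eq_zero] at he
      rwa [sub_eq_zero.1 (he.resolve_left hp0)]
    -- The eigenvalue condition does not depend on i: if it fails, the nilpotent alternative holds
    -- for every i, and the coordinate lies in all U i.
    by_cases hz : ∃ z ∈ Z, q ⬝ᵥ p₀ = (z : ℂˣ)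
    · obtain ⟨z, hz, hqz⟩ := hz
      have he := h.idem_mem hdef hp₀ (h.smul_right q hqC _ (inv_ne_zero z.ne_zero))
        (by rw [smul_dotProduct, hqz, smul_eq_mul, inv_mul_cancel₀ z.ne_zero])
      have := hZS z hz _ he
      rwa [vecMulVec_smul, Units.smul_def, smul_smul, mul_inv_cancel₀ z.ne_zero, one_smul] at this
    · have hx'' := fun i => (hx' i).resolve_right hz
      obtain ⟨c, -, rfl⟩ := hx'' (Classical.arbitrary ι)
      have hc : c ∈ N := by
        rw [hNU]
        refine Set.mem_iInter.2 fun i => ?_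
        obtain ⟨c', hc', he⟩ := hx'' i
        rwa [smul_left_injective ℂ (perp_eq_zero.not.2 hp0) he]
      rcases hc with hc | rfl
      · rw [vecMulVec_smul]; exact hc
      · simp at hq0

/-- With all scalars available, membership of p qᵀ depends only on the lines of p and q, so column
and row conditions suffice. -/
theorem isInter_union_zero_of_univ (h : IsRect S A C) (hdef : IsInftyDefinable (S : Set M2))
    (hA : A.Nonempty) (hC : C.Nonempty) (hZ : ∀ x ∈ S, x ≠ 0 → mult S x = Set.univ) :
    IsInterOfDefinableSemigroups ((S : Set M2) ∪ {0}) := by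
  convert (h.isInter_columnSemigroup (h.lineFinite_or_lineCosmall hdef hC)).inter
    (h.isInter_rows hdef hA) using 1
  refine Set.Subset.antisymm (fun x hx => ?_) ?_
  · by_cases hx0 : x = 0
    · exact ⟨Or.inl hx0, Or.inl (by simp [hx0])⟩
    · obtain ⟨p, hp, q, hq, rfl⟩ := h.exists_vecMulVec x (hx.resolve_right hx0) hx0
      exact ⟨Or.inr ⟨p, hp, q, rfl⟩,
        (h.vecMulVec_mem_rows_iff (h.ne_zero_left hp) (h.ne_zero_right hq)).2 hq⟩
  · rintro x ⟨rfl | ⟨p, hp, q, rfl⟩, hx⟩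
    · exact Or.inr rfl
    · by_cases hx0 : vecMulVec p q = 0
      · exact Or.inr hx0
      · have hq := (h.vecMulVec_mem_rows_iff (h.ne_zero_left hp) (vecMulVec_ne_zero_iff.1 hx0).2).1 hx
        obtain ⟨z, hz⟩ := h.exists_smul_mem p hp q hq
        have : z⁻¹ ∈ mult S (z • vecMulVec p q) := by
          rw [hZ _ hz ((smul_ne_zero_iff_ne z).2 hx0)]; trivial
        left
        simpa [mult] using this

theorem isInter (h : IsRect S A C) (hdef : IsInftyDefinable (S : Set M2)) :
    IsInterOfDefinableSemigroups (S : Set M2) := by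
  by_cases hne : A.Nonempty ∧ C.Nonempty
  swap
  · exact .of_isDefinable (isDefinable_of_finite ((Set.finite_singleton _).subset
      (h.subset_zero hne))) fun x hx => h.det_eq_zero hx
  obtain ⟨⟨p₀, hp₀⟩, q₀, hq₀⟩ := hne
  by_cases hA : ∀ p ∈ A, perp p₀ ⬝ᵥ p = 0
  · exact h.isInter_of_union_zero hdef ⟨p₀, hp₀⟩ ⟨q₀, hq₀⟩
      (h.isInter_union_zero_of_axis hdef hp₀ hA)
  by_cases hC : ∀ q ∈ C, perp q₀ ⬝ᵥ q = 0
  · refine h.isInter_of_union_zero hdef ⟨p₀, hp₀⟩ ⟨q₀, hq₀⟩ ?_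
    convert (h.transposed.isInter_union_zero_of_axis hdef.preimage_transpose hq₀
      hC).preimage_transpose using 1
    ext x
    simp
  push Not at hA hC
  obtain ⟨p₁, hp₁, hpp⟩ := hA
  obtain ⟨q₁, hq₁, hqq⟩ := hC
  -- Both sides now have two independent vectors: a finite H makes S itself finite, and otherwise H
  -- is all of ℂˣ.
  obtain ⟨H, hH, hfin | huniv⟩ := h.exists_equal_mult hdef
    (h.regular_of_exists hp₀ hp₁ hpp hq₀ hq₁ hqq) ⟨p₀, hp₀⟩
  · exact .of_isDefinable (isDefinable_of_finite (h.finite_of_finite_mult hH hfin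
      (h.lineFinite_of_finite_mult hdef hH hfin hq₀ hq₁ hqq)
      (h.lineFinite_of_finite_mult' hdef hH hfin hp₀ hp₁ hpp))) fun x hx => h.det_eq_zero hx
  · exact h.isInter_of_union_zero hdef ⟨p₀, hp₀⟩ ⟨q₀, hq₀⟩
      (h.isInter_union_zero_of_univ hdef ⟨p₀, hp₀⟩ ⟨q₀, hq₀⟩ fun x hx hx0 => huniv ▸ hH x hx hx0)

end IsRect

/-! ### Structure of S in terms of idempotents and nilpotents. -/

theorem dotProduct_eq_one_of_idem {p q : Fin 2 → ℂ} (h : vecMulVec p q ∈ Idem) : q ⬝ᵥ p = 1 := by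
  obtain ⟨h, h0⟩ := h
  rw [vecMulVec_mul_vecMulVec, vecMulVec_smul] at h
  exact smul_left_injective ℂ h0 (h.trans (one_smul ℂ _).symm)

theorem mem_scaleB_iff {F G : Set CP1} {Z : Set ℂˣ} {y : M2} :
    y ∈ scaleB Z F G ↔ y = 0 ∨ ∃ p ∈ cone F, ∃ q ∈ dualCone G, q ⬝ᵥ p = 1 ∧
      ∃ z ∈ Z, y = z • vecMulVec p q := by
  simp only [scaleB, Set.mem_union, Set.mem_singleton_iff, Set.mem_iUnion, Set.mem_ofPred_eq, scale,
    proj_mem_B_iff, exists_prop]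
  refine or_congr_right ⟨?_, ?_⟩
  · rintro ⟨e, ⟨he, h0 | ⟨p, hp, q, hq, rfl⟩⟩, z, hz, rfl⟩
    · exact absurd h0 he.2
    · exact ⟨p, hp, q, hq, dotProduct_eq_one_of_idem he, z, hz, rfl⟩
  · rintro ⟨p, hp, q, hq, hqp, z, hz, rfl⟩
    refine ⟨_, ⟨⟨IsRect.vecMulVec_mul_self hqp, ?_⟩, Or.inr ⟨p, hp, q, hq, rfl⟩⟩, z, hz, rfl⟩
    rintro h0
    rcases vecMulVec_eq_zero.1 h0 with rfl | rfl <;> simp at hqp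

namespace IsRect

variable {S : Subsemigroup M2} {A C : Set (Fin 2 → ℂ)}

theorem exists_idem_smul (h : IsRect S A C) (hdef : IsInftyDefinable (S : Set M2))
    {p q : Fin 2 → ℂ} (hp : p ∈ A) (hq : q ∈ C) (hqp : q ⬝ᵥ p ≠ 0) :
    ∃ q' ∈ C, q' ⬝ᵥ p = 1 ∧ vecMulVec p q' ∈ (S : Set M2) ∩ Idem ∧
      vecMulVec p q = Units.mk0 _ hqp • vecMulVec p q' := by
  have hq' := h.smul_right q hq _ (inv_ne_zero hqp)
  have h1 : (q ⬝ᵥ p)⁻¹ • q ⬝ᵥ p = 1 := by rw [smul_dotProduct, smul_eq_mul, inv_mul_cancel₀ hqp]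
  refine ⟨_, hq', h1, ⟨h.idem_mem hdef hp hq' h1, vecMulVec_mul_self h1,
    vecMulVec_ne_zero_iff.2 ⟨h.ne_zero_left hp, h.ne_zero_right hq'⟩⟩, ?_⟩
  rw [vecMulVec_smul, Units.smul_mk0, smul_smul, mul_inv_cancel₀ hqp, one_smul]

theorem mul_self_ne_zero (h : IsRect S A C) {p q : Fin 2 → ℂ} (hp : p ∈ A) (hq : q ∈ C)
    (hqp : q ⬝ᵥ p ≠ 0) : vecMulVec p q * vecMulVec p q ≠ 0 := by
  rw [vecMulVec_mul_vecMulVec, vecMulVec_smul]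
  exact smul_ne_zero hqp (vecMulVec_ne_zero_iff.2 ⟨h.ne_zero_left hp, h.ne_zero_right hq⟩)

/-- Equal multiplicity turns the nonnilpotent part of `S` into a union of multiples of
idempotents. -/
theorem eq_union_scale (h : IsRect S A C) (hdef : IsInftyDefinable (S : Set M2)) {Z : Set ℂˣ}
    (hZ : ∀ x ∈ S, x ≠ 0 → mult S x = Z) :
    (S : Set M2) \ Nil = ⋃ e ∈ (S : Set M2) ∩ Idem, scale Z e := by
  ext x
  simp only [Set.mem_iUnion, exists_prop, scale, Set.mem_ofPred_eq]
  constructor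
  · rintro ⟨hx, hnil⟩
    obtain ⟨p, hp, q, hq, rfl⟩ := h.exists_vecMulVec x hx
      fun h0 => hnil (by rw [h0]; exact mul_zero _)
    have hqp : q ⬝ᵥ p ≠ 0 := fun h0 => hnil (by
      change _ * _ = 0
      rw [vecMulVec_mul_vecMulVec, h0, zero_smul, vecMulVec_zero])
    obtain ⟨q', -, -, he, heq⟩ := h.exists_idem_smul hdef hp hq hqp
    refine ⟨_, he, _, ?_, heq⟩
    rw [← hZ _ he.1 he.2.2]
    change _ • _ ∈ S
    rwa [← heq]
  · rintro ⟨e, he, z, hz, rfl⟩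
    rw [← hZ e he.1 he.2.2] at hz
    refine ⟨hz, fun h0 => ?_⟩
    have h0 : z • e * z • e = 0 := h0
    rw [smul_mul_smul_comm, he.2.1] at h0
    exact (smul_ne_zero_iff_ne _).2 he.2.2 h0

/-- A nonzero nilpotent has its image as kernel, so a common image determines it up to a scalar. -/
theorem exists_smul_of_nil (h : IsRect S A C) {p₀ : Fin 2 → ℂ} (hp₀ : p₀ ∈ A)
    (hA : ∀ p ∈ A, perp p₀ ⬝ᵥ p = 0) {n x : M2} (hn : n ∈ S) (hnil : n * n = 0) (hn0 : n ≠ 0)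
    (hx : x ∈ S) (hxnil : x * x = 0) (hx0 : x ≠ 0) : ∃ c : ℂˣ, x = c • n := by
  have key : ∀ y ∈ S, y * y = 0 → y ≠ 0 → ∃ c : ℂ, c ≠ 0 ∧ y = c • vecMulVec p₀ (perp p₀) := by
    intro y hy hyy hy0
    obtain ⟨p, hp, q, hq, rfl⟩ := h.exists_vecMulVec y hy hy0
    have hqp : q ⬝ᵥ p = 0 := by
      by_contra hqp
      exact h.mul_self_ne_zero hp hq hqp hyy
    obtain ⟨a, ha, rfl⟩ := exists_eq_smul_of_dotProduct_eq_zero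
      (perp_eq_zero.not.2 (h.ne_zero_left hp₀)) (h.ne_zero_left hp₀) (h.ne_zero_left hp)
      (perp_dotProduct_self _) (hA p hp)
    rw [dotProduct_comm] at hqp
    obtain ⟨b, rfl⟩ := exists_eq_smul_perp (h.ne_zero_left hp) hqp
    have hb : b ≠ 0 := fun hb => h.ne_zero_right hq (by rw [hb, zero_smul])
    refine ⟨a * (b * a), mul_ne_zero ha (mul_ne_zero hb ha), ?_⟩
    rw [perp_smul, smul_smul, smul_vecMulVec, vecMulVec_smul, smul_smul]
  obtain ⟨a, ha, rfl⟩ := key n hn hnil hn0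
  obtain ⟨b, hb, rfl⟩ := key x hx hxnil hx0
  exact ⟨Units.mk0 (b / a) (div_ne_zero hb ha), by
    rw [Units.smul_mk0, smul_smul, div_mul_cancel₀ _ ha]⟩

theorem mem_iff_of_axis (h : IsRect S A C) (hdef : IsInftyDefinable (S : Set M2))
    {p₀ : Fin 2 → ℂ} (hp₀ : p₀ ∈ A) (hA : ∀ p ∈ A, perp p₀ ⬝ᵥ p = 0) {n e : M2} (hn : n ∈ S)
    (hnil : n * n = 0) (hn0 : n ≠ 0) (he : e ∈ (S : Set M2) ∩ Idem) (x : M2) :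
    x ∈ S ↔ (x = 0 ∨ ∃ p ∈ A, ∃ q ∈ C, q ⬝ᵥ p = 1 ∧ ∃ z ∈ mult S e, x = z • vecMulVec p q) ∨
      ∃ z ∈ mult S n, x = z • n := by
  obtain ⟨p', hp', q', hq', rfl⟩ := h.exists_vecMulVec e he.1 he.2.2
  have hqp' := dotProduct_eq_one_of_idem he.2
  have par : ∀ p ∈ A, ∃ a : ℂ, p' = a • p := fun p hp => by
    obtain ⟨a, -, ha⟩ := exists_eq_smul_of_dotProduct_eq_zero
      (perp_eq_zero.not.2 (h.ne_zero_left hp₀)) (h.ne_zero_left hp) (h.ne_zero_left hp')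
      (hA p hp) (hA p' hp')
    exact ⟨a, ha⟩
  constructor
  · intro hx
    by_cases hx0 : x = 0
    · exact Or.inl (Or.inl hx0)
    by_cases hxnil : x * x = 0
    · obtain ⟨c, rfl⟩ := h.exists_smul_of_nil hp₀ hA hn hnil hn0 hx hxnil hx0
      exact Or.inr ⟨c, hx, rfl⟩
    obtain ⟨p, hp, q, hq, rfl⟩ := h.exists_vecMulVec x hx hx0
    have hqp : q ⬝ᵥ p ≠ 0 := fun h0 => hxnil (by
      rw [vecMulVec_mul_vecMulVec, h0, zero_smul, vecMulVec_zero])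
    obtain ⟨q₁, hq₁, hqp₁, -, heq⟩ := h.exists_idem_smul hdef hp hq hqp
    refine Or.inl (Or.inr ⟨p, hp, q₁, hq₁, hqp₁, _, ?_, heq⟩)
    -- As p and p' are parallel, x e = (q ⬝ p) e, which puts the eigenvalue of x in Z_e.
    have := S.mul_mem hx he.1
    obtain ⟨a, ha⟩ := par p hp
    change _ • _ ∈ S
    convert this using 1
    rw [Units.smul_mk0, vecMulVec_mul_vecMulVec, ha, dotProduct_smul, smul_vecMulVec,
      vecMulVec_smul, smul_smul, smul_eq_mul, mul_comm]
  · rintro ((rfl | ⟨p, hp, q, hq, hqp, z, hz, rfl⟩) | ⟨z, hz, rfl⟩)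
    · exact hnil ▸ S.mul_mem hn hn
    -- Idempotents e, f with the same image satisfy e f = f, hence (z e) f = z f.
    · have := S.mul_mem hz (h.idem_mem hdef hp hq hqp)
      obtain ⟨a, ha⟩ := par p hp
      have h1 : a * (q' ⬝ᵥ p) = 1 := by
        rw [← hqp', ha, dotProduct_smul, smul_eq_mul]
      convert this using 1
      rw [smul_mul_assoc, vecMulVec_mul_vecMulVec, ha, smul_vecMulVec, vecMulVec_smul, smul_smul, h1,
        one_smul]
    · exact hz

theorem mem_iff_of_axis_of_no_idem (h : IsRect S A C) (hdef : IsInftyDefinable (S : Set M2))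
    {p₀ : Fin 2 → ℂ} (hp₀ : p₀ ∈ A) (hA : ∀ p ∈ A, perp p₀ ⬝ᵥ p = 0) {n : M2} (hn : n ∈ S)
    (hnil : n * n = 0) (hn0 : n ≠ 0) (he : (S : Set M2) ∩ Idem = ∅) (x : M2) :
    x ∈ S ↔ x = 0 ∨ ∃ z ∈ mult S n, x = z • n := by
  constructor
  · intro hx
    by_cases hx0 : x = 0
    · exact Or.inl hx0
    have hxnil : x * x = 0 := by
      obtain ⟨p, hp, q, hq, rfl⟩ := h.exists_vecMulVec x hx hx0
      by_cases hqp : q ⬝ᵥ p = 0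
      · rw [vecMulVec_mul_vecMulVec, hqp, zero_smul, vecMulVec_zero]
      · obtain ⟨q', -, -, hmem, -⟩ := h.exists_idem_smul hdef hp hq hqp
        rw [he] at hmem
        exact hmem.elim
    obtain ⟨c, rfl⟩ := h.exists_smul_of_nil hp₀ hA hn hnil hn0 hx hxnil hx0
    exact Or.inr ⟨c, hx, rfl⟩
  · rintro (rfl | ⟨z, hz, rfl⟩)
    · exact hnil ▸ S.mul_mem hn hn
    · exact hz

theorem mult_transposed (x : M2) : mult (SingularSemigroup.transposed S) xᵀ = mult S x := by
  ext z
  simp [mult]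

theorem transpose_mem_idem {e : M2} (he : e ∈ Idem) : eᵀ ∈ Idem :=
  ⟨by rw [← transpose_mul, he.1], by simpa using he.2⟩

end IsRect

/-! ### The cases of the proposition. -/

section Main

variable {S : Subsemigroup M2} {F G : Set CP1}

theorem eq_univ_of_infinite (h : IsRect S (cone F) (dualCone G))
    (hdef : IsInftyDefinable (S : Set M2)) {H : Subgroup ℂˣ}
    (hH : ∀ x ∈ S, x ≠ 0 → mult S x = H)
    (hfin : (H : Set ℂˣ).Finite ∨ (H : Set ℂˣ) = Set.univ) (hB : (B F G).Infinite)
    (hF : 1 < F.encard) (hG : 1 < G.encard) : (H : Set ℂˣ) = Set.univ := by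
  obtain ⟨p, hp, p', hp', hpp⟩ := exists_mem_cone_of_one_lt_encard hF
  obtain ⟨q, hq, q', hq', hqq⟩ := exists_mem_dualCone_of_one_lt_encard hG
  refine hfin.resolve_left fun hfin => hB (IsRect.finite_B ?_ ?_)
  · exact h.lineFinite_of_finite_mult hdef hH hfin hq hq' hqq
  · exact h.lineFinite_of_finite_mult' hdef hH hfin hp hp' hpp

theorem structure_of_no_nilpotent (h : IsRect S (cone F) (dualCone G))
    (hdef : IsInftyDefinable (S : Set M2)) (hnil : ∀ n ∈ S, n ∈ Nil → n = 0) :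
    ∃ Z : Set ℂˣ, HasEqualMultiplicity (S : Set M2) Z ∧
      (S : Set M2) ∪ {0} = scaleB Z F G ∧
      (S : Set M2) \ {0} = ⋃ e ∈ (S : Set M2) ∩ Idem, scale Z e ∧
      ((B F G).Infinite → 1 < F.encard → 1 < G.encard → Z = Set.univ) := by
  obtain ⟨Z, hZ, hZ1, hinf⟩ : ∃ Z : Set ℂˣ, HasEqualMultiplicity (S : Set M2) Z ∧
      (∀ p ∈ cone F, ∀ q ∈ dualCone G, ∀ z ∈ Z, q ⬝ᵥ p = 1 → z • vecMulVec p q ∈ S) ∧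
      ((B F G).Infinite → 1 < F.encard → 1 < G.encard → Z = Set.univ) := by
    by_cases hne : (cone F).Nonempty ∧ (dualCone G).Nonempty
    · obtain ⟨H, hH, hfin⟩ := h.exists_equal_mult hdef (IsRect.regular_of_forall hne.1 hne.2
        fun p hp q hq => h.dotProduct_ne_zero_of_nil hnil hp hq) hne.1
      refine ⟨H, hH, fun p hp q hq z hz hqp => ?_, eq_univ_of_infinite h hdef hH hfin⟩
      rw [← hH _ (h.idem_mem hdef hp hq hqp)
        (vecMulVec_ne_zero_iff.2 ⟨h.ne_zero_left hp, h.ne_zero_right hq⟩)] at hz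
      exact hz
    -- If F or G is empty then S ⊆ {0}; any Z has equal multiplicity, and ℂˣ also meets the last
    -- clause.
    · exact ⟨Set.univ, fun x hx hx0 => absurd (h.subset_zero hne hx) hx0,
        fun p hp q hq => absurd ⟨⟨p, hp⟩, ⟨q, hq⟩⟩ hne, fun _ _ _ => rfl⟩
  refine ⟨Z, hZ, ?_, ?_, hinf⟩
  · ext x
    rw [mem_scaleB_iff, Set.mem_union, or_comm]
    refine or_congr_right' fun hx0 => ⟨fun hx => ?_, ?_⟩
    · obtain ⟨p, hp, q, hq, rfl⟩ := h.exists_vecMulVec x hx hx0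
      obtain ⟨q', hq', hqp', he, heq⟩ := h.exists_idem_smul hdef hp hq
        (h.dotProduct_ne_zero_of_nil hnil hp hq)
      refine ⟨p, hp, q', hq', hqp', _, ?_, heq⟩
      rw [← hZ _ he.1 he.2.2]
      change _ • _ ∈ S
      rwa [← heq]
    · rintro ⟨p, hp, q, hq, hqp, z, hz, rfl⟩
      exact hZ1 p hp q hq z hz hqp
  · rw [← h.eq_union_scale hdef hZ]
    ext x
    refine and_congr_right fun hx => not_congr ⟨?_, hnil x hx⟩
    rintro rfl
    exact mul_zero _

theorem structure_of_nilpotent_of_one_lt (h : IsRect S (cone F) (dualCone G))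
    (hdef : IsInftyDefinable (S : Set M2)) (h0 : (0 : M2) ∈ S) (hF : 1 < F.encard)
    (hG : 1 < G.encard) :
    ∃ Z : Set ℂˣ, HasEqualMultiplicity (S : Set M2) Z ∧
      (S : Set M2) = (⋃ e ∈ (S : Set M2) ∩ Idem, scale Z e) ∪ ((S : Set M2) ∩ Nil) ∧
      ((B F G).Infinite → Z = Set.univ ∧ (S : Set M2) = proj ⁻¹' (B F G)) := by
  obtain ⟨p, hp, p', hp', hpp⟩ := exists_mem_cone_of_one_lt_encard hF
  obtain ⟨q, hq, q', hq', hqq⟩ := exists_mem_dualCone_of_one_lt_encard hG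
  obtain ⟨H, hH, hfin⟩ := h.exists_equal_mult hdef
    (h.regular_of_exists hp hp' hpp hq hq' hqq) ⟨p, hp⟩
  refine ⟨H, hH, ?_, fun hB => ?_⟩
  · rw [← h.eq_union_scale hdef hH, Set.sdiff_union_inter]
  · have huniv := eq_univ_of_infinite h hdef hH hfin hB hF hG
    refine ⟨huniv, Set.ext fun x => ?_⟩
    rw [Set.mem_preimage, proj_mem_B_iff]
    constructor
    · exact fun hx => or_iff_not_imp_left.2 (h.exists_vecMulVec x hx)
    · rintro (rfl | ⟨p, hp, q, hq, rfl⟩)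
      · exact h0
      · obtain ⟨z, hz⟩ := h.exists_smul_mem p hp q hq
        have : z⁻¹ ∈ mult S (z • vecMulVec p q) := by
          rw [hH _ hz ((smul_ne_zero_iff_ne z).2
            (vecMulVec_ne_zero_iff.2 ⟨h.ne_zero_left hp, h.ne_zero_right hq⟩)), huniv]
          trivial
        simpa [mult] using this

theorem structure_of_nilpotent_of_eq_one (h : IsRect S (cone F) (dualCone G))
    (hdef : IsInftyDefinable (S : Set M2)) (hFG : F.encard = 1 ∨ G.encard = 1) {n : M2}
    (hn : n ∈ S) (hnil : n * n = 0) (hn0 : n ≠ 0) :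
    (∀ e ∈ (S : Set M2) ∩ Idem,
      (S : Set M2) = scaleB (mult S e) F G ∪ scale (mult S n) n) ∧
    ((S : Set M2) ∩ Idem = ∅ → (S : Set M2) = {0} ∪ scale (mult S n) n) := by
  rcases hFG with hF | hG
  · obtain ⟨p₀, hp₀, hA⟩ := exists_mem_cone_of_encard_eq_one hF
    refine ⟨fun e he => Set.ext fun x => ?_, fun he => Set.ext fun x => ?_⟩
    · rw [Set.mem_union, mem_scaleB_iff]
      exact h.mem_iff_of_axis hdef hp₀ hA hn hnil hn0 he x
    · exact h.mem_iff_of_axis_of_no_idem hdef hp₀ hA hn hnil hn0 he x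
  · obtain ⟨q₀, hq₀, hC⟩ := exists_mem_dualCone_of_encard_eq_one hG
    have hnt : nᵀ ∈ transposed S := by simpa
    have hntnil : nᵀ * nᵀ = 0 := by rw [← transpose_mul, hnil, transpose_zero]
    have hnt0 : nᵀ ≠ 0 := by simpa
    refine ⟨fun e he => Set.ext fun x => ?_, fun he => Set.ext fun x => ?_⟩
    · rw [Set.mem_union, mem_scaleB_iff]
      have := h.transposed.mem_iff_of_axis hdef.preimage_transpose hq₀ hC hnt hntnil hnt0
        (e := eᵀ) ⟨by simpa using he.1, IsRect.transpose_mem_idem he.2⟩ xᵀ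
      rw [mem_transposed, transpose_transpose] at this
      refine this.trans (or_congr (or_congr (by simp) ?_) ?_)
      · constructor
        · rintro ⟨q, hq, p, hp, hqp, z, hz, hx⟩
          refine ⟨p, hp, q, hq, by rwa [dotProduct_comm], z, by rwa [IsRect.mult_transposed] at hz, ?_⟩
          rw [← transpose_transpose x, hx, transpose_smul, transpose_vecMulVec]
        · rintro ⟨p, hp, q, hq, hqp, z, hz, rfl⟩
          refine ⟨q, hq, p, hp, by rwa [dotProduct_comm], z, by rwa [IsRect.mult_transposed], ?_⟩
          rw [transpose_smul, transpose_vecMulVec]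
      · simp only [IsRect.mult_transposed, ← transpose_smul, transpose_inj]; rfl
    · have := h.transposed.mem_iff_of_axis_of_no_idem hdef.preimage_transpose hq₀ hC hnt hntnil hnt0
        (Set.eq_empty_of_forall_notMem fun e he' => by
          have : eᵀ ∈ (S : Set M2) ∩ Idem := ⟨he'.1, IsRect.transpose_mem_idem he'.2⟩
          rw [he] at this
          exact this) xᵀ
      rw [mem_transposed, transpose_transpose] at this
      refine this.trans (or_congr (by simp) ?_)
      simp only [IsRect.mult_transposed, ← transpose_smul, transpose_inj]; rfl

end Main

end SingularSemigroup

open SingularSemigroup in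
theorem propositionP (S : Subsemigroup M2) (hsing : ∀ x ∈ S, x.det = 0)
    (hdef : IsInftyDefinable (S : Set M2)) (F G : Set CP1)
    (hS : proj '' (S : Set M2) = B F G ∨ proj '' (S : Set M2) = B F G \ {proj 0}) :
    -- no nonzero nilpotents
    ((∀ n ∈ S, n ∈ Nil → n = 0) →
      ∃ Z : Set ℂˣ, HasEqualMultiplicity (S : Set M2) Z ∧
        (S : Set M2) ∪ {0} = scaleB Z F G ∧
        (S : Set M2) \ {0} = ⋃ e ∈ (S : Set M2) ∩ Idem, scale Z e ∧
        ((B F G).Infinite → 1 < F.encard → 1 < G.encard → Z = Set.univ)) ∧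
    -- some nonzero nilpotent
    ((∃ n ∈ S, n ∈ Nil ∧ n ≠ 0) →
      (1 < F.encard → 1 < G.encard →
        ∃ Z : Set ℂˣ, HasEqualMultiplicity (S : Set M2) Z ∧
          (S : Set M2) = (⋃ e ∈ (S : Set M2) ∩ Idem, scale Z e) ∪ ((S : Set M2) ∩ Nil) ∧
          ((B F G).Infinite → Z = Set.univ ∧ (S : Set M2) = proj ⁻¹' (B F G))) ∧
      (F.encard = 1 ∨ G.encard = 1 →
        ∀ n ∈ S, n ∈ Nil → n ≠ 0 →
          (∀ e ∈ (S : Set M2) ∩ Idem,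
            (S : Set M2) = scaleB (mult S e) F G ∪ scale (mult S n) n) ∧
          ((S : Set M2) ∩ Idem = ∅ → (S : Set M2) = {0} ∪ scale (mult S n) n))) ∧
    -- without zero only the first case occurs
    ((0 : M2) ∉ S → ∀ n ∈ S, n ∉ Nil) ∧
    IsInterOfDefinableSemigroups (S : Set M2) := by
  have h := isRect_of_image_proj hS
  refine ⟨structure_of_no_nilpotent h hdef, fun ⟨n, hn, hnil, _⟩ => ⟨?_, ?_⟩, ?_, h.isInter hdef⟩
  · have h0 : n * n ∈ S := S.mul_mem hn hn
    rw [show n * n = 0 from hnil] at h0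
    exact structure_of_nilpotent_of_one_lt h hdef h0
  · exact fun hFG m hm hmnil hm0 => structure_of_nilpotent_of_eq_one h hdef hFG hm hmnil hm0
  · intro h0 n hn hnil
    have := S.mul_mem hn hn
    rw [show n * n = 0 from hnil] at this
    exact h0 this
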